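/- Let $k\ge 2$ and let $\Gamma=F(A_1,\dots,A_k)$ be the free group on $k$ generators. For $1\le j\le k$ let $\log_j:\Gamma\to\mathbb Z$ be the homomorphism with $\log_j(A_i)=\delta_{ij}$, and let $\Phi(\gamma)=(\log_1(\gamma),\dots,\log_k(\gamma))\in\mathbb Z^k$, which depends only on the conjugacy class $\{\gamma\}$ of $\gamma$. The length $l(\{\gamma\})$ of a conjugacy class is the length of the cyclically reduced word obtained from any representative (equivalently, the minimal word length of its elements). For an integer $m\ge 0$ and a set $B\subseteq\mathbb Z^k$ let $$\Pi(m)=\#\{\{\gamma\} : l(\{\gamma\})\le m\},\qquad \Pi_B(m)=\#\{\{\gamma\} : l(\{\gamma\})\le m,\ \Phi(\{\gamma\})\in B\},$$ where $\{\gamma\}$ ranges over the conjugacy classes of $\Gamma$. Let $C\subseteq\mathbb Z^k$ be the set of points whose coordinates are relatively prime, that is, $\gcd(v_1,\dots,v_k)=1$. Then $$\frac12\left(\frac{\Pi_C(m)}{\Pi(m)}+\frac{\Pi_C(m+1)}{\Pi(m+1)}\right)\longrightarrow\frac1{\zeta(k)}\qquad\text{as } m\to\infty,$$ where $\zeta$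 is the Riemann zeta function. -/

import Mathlib

open Filter Topology

namespace FreeGroupClasses

/-- The `j`-th discrete logarithm on the free group on generators indexed by `Fin k`: the
homomorphism to (the multiplicative copy of) `ℤ` sending the `i`-th generator to `δ_{ij}`. -/
def discreteLog {k : ℕ} (j : Fin k) : FreeGroup (Fin k) →* Multiplicative ℤ :=
  FreeGroup.lift fun i => Multiplicative.ofAdd (if i = j then 1 else 0)

/-- The vector of discrete logarithms of an element of the free group. -/
def logVector {k : ℕ} (g : FreeGroup (Fin k)) : Fin k → ℤ :=
  fun j => Multiplicative.toAdd (discreteLog j g)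

theorem logVector_eq_of_isConj {k : ℕ} {g h : FreeGroup (Fin k)} (hgh : IsConj g h) :
    logVector g = logVector h := by
  funext j
  have h1 : IsConj (discreteLog j g) (discreteLog j h) := (discreteLog j).map_isConj hgh
  rw [isConj_iff_eq] at h1
  simp [logVector, h1]

/-- The vector of discrete logarithms of a conjugacy class. -/
def classLogVector {k : ℕ} (c : ConjClasses (FreeGroup (Fin k))) : Fin k → ℤ :=
  Quotient.lift logVector (fun _ _ h => logVector_eq_of_isConj h) c

/-- The cyclically reduced length of an element: the length of the cyclic reduction of its
reduced word. -/
def cyclicLength {k : ℕ} (g : FreeGroup (Fin k)) : ℕ :=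
  (FreeGroup.reduceCyclically g.toWord).length

theorem exists_cyclic_rep {k : ℕ} (g : FreeGroup (Fin k)) :
    ∃ w : FreeGroup (Fin k), IsConj w g ∧ w.toWord = FreeGroup.reduceCyclically g.toWord := by
  have hred : FreeGroup.IsCyclicallyReduced (FreeGroup.reduceCyclically g.toWord) :=
    FreeGroup.reduceCyclically.isCyclicallyReduced FreeGroup.isReduced_toWord
  refine ⟨FreeGroup.mk (FreeGroup.reduceCyclically g.toWord), ?_, ?_⟩
  · rw [isConj_iff]
    refine ⟨FreeGroup.mk (FreeGroup.reduceCyclically.conjugator g.toWord), ?_⟩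
    rw [FreeGroup.inv_mk, FreeGroup.mul_mk, FreeGroup.mul_mk,
      FreeGroup.reduceCyclically.conj_conjugator_reduceCyclically, FreeGroup.mk_toWord]
  · rw [FreeGroup.toWord_mk, hred.isReduced.reduce_eq]

theorem norm_pow_le {k : ℕ} (g : FreeGroup (Fin k)) (n : ℕ) : (g ^ n).norm ≤ n * g.norm := by
  induction n with
  | zero => simp
  | succ n ih =>
    rw [pow_succ]
    have := FreeGroup.norm_mul_le (g ^ n) g
    rw [add_mul, one_mul]
    omega

theorem cyclicLength_le_norm_of_isConj {k : ℕ} {g h : FreeGroup (Fin k)} (hgh : IsConj g h) :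
    cyclicLength g ≤ h.norm := by
  obtain ⟨w, hw, hword⟩ := exists_cyclic_rep g
  have hred : FreeGroup.IsCyclicallyReduced w.toWord := by
    rw [hword]
    exact FreeGroup.reduceCyclically.isCyclicallyReduced FreeGroup.isReduced_toWord
  have hpow : ∀ n : ℕ, (w ^ n).norm = n * cyclicLength g := by
    intro n
    rw [FreeGroup.norm, FreeGroup.toWord_pow,
      (hred.flatten_replicate n).isReduced.reduce_eq]
    simp [cyclicLength, hword]
  obtain ⟨a, ha⟩ := isConj_iff.1 (hw.trans hgh).symm
  have key : ∀ n : ℕ, n * cyclicLength g ≤ 2 * a.norm + n * h.norm := by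
    intro n
    have e : w ^ n = a * h ^ n * a⁻¹ := by rw [← ha, conj_pow]
    have h1 := FreeGroup.norm_mul_le (a * h ^ n) a⁻¹
    have h2 := FreeGroup.norm_mul_le a (h ^ n)
    have h3 := norm_pow_le h n
    rw [FreeGroup.norm_inv_eq] at h1
    rw [← hpow n, e]
    omega
  by_contra! hlt
  have := key (2 * a.norm + 1)
  nlinarith

theorem cyclicLength_eq_of_isConj {k : ℕ} {g h : FreeGroup (Fin k)} (hgh : IsConj g h) :
    cyclicLength g = cyclicLength h := by
  have aux : ∀ {x y : FreeGroup (Fin k)}, IsConj x y → cyclicLength x ≤ cyclicLength y := by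
    intro x y hxy
    obtain ⟨w, hw, hword⟩ := exists_cyclic_rep y
    have := cyclicLength_le_norm_of_isConj (hxy.trans hw.symm)
    rwa [FreeGroup.norm, hword] at this
  exact le_antisymm (aux hgh) (aux hgh.symm)

/-- The length of a conjugacy class: the cyclically reduced length of any representative. -/
def classLength {k : ℕ} (c : ConjClasses (FreeGroup (Fin k))) : ℕ :=
  Quotient.lift cyclicLength (fun _ _ h => cyclicLength_eq_of_isConj h) c

/-- Only finitely many conjugacy classes have length at most `m`, so that the cardinalities
below are genuine. -/
theorem finite_classLength_le (k m : ℕ) :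
    {c : ConjClasses (FreeGroup (Fin k)) | classLength c ≤ m}.Finite := by
  refine ((List.finite_length_le (Fin k × Bool) m).image
    (fun L => ConjClasses.mk (FreeGroup.mk L))).subset ?_
  intro c hc
  obtain ⟨g, rfl⟩ := ConjClasses.exists_rep c
  obtain ⟨w, hw, hword⟩ := exists_cyclic_rep g
  refine ⟨w.toWord, ?_, ?_⟩
  · rw [hword]
    exact hc
  · simpa [FreeGroup.mk_toWord] using ConjClasses.mk_eq_mk_iff_isConj.2 hw

/-- The number of conjugacy classes of length at most `m`. -/
noncomputable def classCount (k m : ℕ) : ℕ :=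
  {c : ConjClasses (FreeGroup (Fin k)) | classLength c ≤ m}.ncard

/-- The number of conjugacy classes of length at most `m` whose vector of discrete logarithms
lies in `B`. -/
noncomputable def classCountIn {k : ℕ} (B : Set (Fin k → ℤ)) (m : ℕ) : ℕ :=
  {c : ConjClasses (FreeGroup (Fin k)) | classLength c ≤ m ∧ classLogVector c ∈ B}.ncard

/-- The integer points with (jointly) relatively prime coordinates. -/
def coprimePoints (k : ℕ) : Set (Fin k → ℤ) :=
  {v | Finset.univ.gcd v = 1}

end FreeGroupClasses

/-!
Put `q = 2 k - 1`. A conjugacy class of length `n` consists, as far as cyclically reduced words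
are concerned, of the rotations of one word (`isRotated_of_isConj`); unless the word has a
rotational symmetry these are `n` different words, and symmetric words are exponentially rare.
So the conjugacy classes of length `n` with exponent sums in a set `B` number, up to a negligible
error, `1 / n` times the cyclically reduced words of length `n` with exponent sums in `B`
(`abs_mul_card_classesIn_sub_le`), and the latter are studied with characters.

A cyclically reduced word is a closed walk on the letters that never follows a letter by its
inverse. Hence the sum of a character over these words is the trace of a power of a weighted
transition matrix. That matrix is a rank one matrix minus an involution, and this gives the trace
formula `sum_cyclicWords_character`: up to a bounded term the sum is `αⁿ + βⁿ` with `α`, `β` the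
roots of `x² - 2 S x + q`, where `2 S` is the sum of the character over all letters. Therefore
`|sum| ≤ 2 k qⁿ exp (-n (k - |S|) / (4 k))` when `|S| ≤ k` (`abs_wordSum_le`); real characters give
in the same way exponential moments of the exponent sums on the scale `√n`
(`wordFrequency_farPoints_le`).

Summing over the characters modulo `d` counts the words all of whose exponent sums are divisible
by `d`. Only the trivial character (`S = k`) and, for even `d`, the parity of the length
(`S = -k`) survive in the limit; the latter cancels over two consecutive lengths, which is why the
average of two terms appears. This gives the frequency `1 / d ^ k`
(`tendsto_wordFrequency_divisible`), together with a bound `C / d ^ 2` uniform in `d ≤ R √n`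
(`exists_wordFrequency_divisible_le`).

A Möbius sieve over the divisors of `M !` gives words whose gcd of exponent sums is prime to
`M !` the frequency `∑ μ(d) / d ^ k`, over `d ∣ M !`. The words among these with gcd different
from `1` have gcd larger than `M`, so they are far out or divisible by some `d` with
`M < d ≤ R √n`; the two uniform bounds make their frequency small. Letting `M` tend to infinity
yields `1 / ζ(k)` (`tendsto_wordFrequency_coprimePoints`). Finally the counts for a given length
grow by the factor `q`, and the alternation between even and odd lengths passes to the cumulative
counts (`tendsto_weighted_average_add`).
-/

namespace FreeGroupClasses

open FreeGroup hiding IsReduced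

/-! ### Lists of given length and their rotations -/

/-- The lists of length `n` over a finite alphabet, as a finset built by prepending letters. -/
def lists (α : Type*) [Fintype α] [DecidableEq α] : ℕ → Finset (List α)
  | 0 => {[]}
  | n + 1 => (Finset.univ ×ˢ lists α n).image fun p => p.1 :: p.2

/-- A list fixed by the rotation by `r` is determined by its first `r` letters. -/
theorem eq_of_rotate_eq {α : Type*} {r : ℕ} {L L' : List α} (hlen : L.length = L'.length)
    (hL : L.rotate r = L) (hL' : L'.rotate r = L') (hr : 0 < r)
    (htake : L.take r = L'.take r) : L = L' := by
  have step : ∀ M : List α, M.rotate r = M → ∀ i (hi : i < M.length), r ≤ i →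
      M[i] = M[i - r]'(by omega) := by
    intro M hM i hi hri
    have h1 : (M.rotate r)[i - r]'(by rw [List.length_rotate]; omega) = M[i] := by
      rw [List.getElem_rotate]
      congr 1
      rw [Nat.sub_add_cancel hri, Nat.mod_eq_of_lt hi]
    rw [← h1]
    simp only [hM]
  refine List.ext_getElem hlen fun i => ?_
  induction i using Nat.strong_induction_on with
  | _ i ih =>
    intro hi hi'
    rcases lt_or_ge i r with h | h
    · have h1 : (L.take r)[i]'(by simp; omega) = (L'.take r)[i]'(by simp; omega) := by
        simp only [htake]
      simpa using h1
    · rw [step L hL i hi h, step L' hL' i hi' h]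
      exact ih (i - r) (by omega) _ _

section Lists

variable {α : Type*} [Fintype α] [DecidableEq α]

theorem mem_lists {n : ℕ} {L : List α} : L ∈ lists α n ↔ L.length = n := by
  induction n generalizing L with
  | zero => simp [lists]
  | succ n ih =>
    cases L with
    | nil => simp [lists]
    | cons a L => simp [lists, ih]

theorem sum_lists_succ {M : Type*} [AddCommMonoid M] (n : ℕ) (F : List α → M) :
    ∑ L ∈ lists α (n + 1), F L = ∑ a, ∑ L ∈ lists α n, F (a :: L) := by
  rw [lists, Finset.sum_image (by rintro ⟨a, L⟩ _ ⟨b, M⟩ _ h; simpa using h),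
    Finset.sum_product]

theorem card_lists (n : ℕ) : (lists α n).card = Fintype.card α ^ n := by
  induction n with
  | zero => simp [lists]
  | succ n ih =>
    rw [Finset.card_eq_sum_ones, sum_lists_succ]
    simp [ih, pow_succ']

open Classical in
/-- The lists of length `n` having a nontrivial rotational symmetry. -/
noncomputable def symmetricLists (α : Type*) [Fintype α] [DecidableEq α] (n : ℕ) :
    Finset (List α) :=
  (lists α n).filter fun L => ∃ r, 0 < r ∧ r < n ∧ L.rotate r = L

theorem card_symmetricLists_le [Nonempty α] (n : ℕ) :
    (symmetricLists α n).card ≤ n * Fintype.card α ^ (n / 2) := by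
  classical
  have hsub : symmetricLists α n ⊆ (Finset.Icc 1 (n / 2)).biUnion
      fun r => (lists α n).filter fun L => L.rotate r = L := by
    intro L hL
    simp only [symmetricLists, Finset.mem_filter, mem_lists] at hL
    obtain ⟨hn, r, h0, hr, hrot⟩ := hL
    simp only [Finset.mem_biUnion, Finset.mem_Icc, Finset.mem_filter, mem_lists]
    rcases le_or_gt r (n / 2) with h | h
    · exact ⟨r, ⟨h0, h⟩, hn, hrot⟩
    · -- the inverse rotation is also a symmetry, and it is the shorter one
      refine ⟨n - r, ⟨by omega, by omega⟩, hn, ?_⟩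
      conv_lhs => rw [← hrot]
      rw [List.rotate_rotate, show r + (n - r) = L.length by omega, List.rotate_length]
  refine (Finset.card_le_card hsub).trans (Finset.card_biUnion_le.trans ?_)
  have hb : ∀ r ∈ Finset.Icc 1 (n / 2),
      ((lists α n).filter fun L => L.rotate r = L).card ≤ Fintype.card α ^ (n / 2) := by
    intro r hr
    rw [Finset.mem_Icc] at hr
    refine le_trans ?_ (Nat.pow_le_pow_right Fintype.card_pos hr.2)
    rw [← card_lists (α := α) r]
    refine Finset.card_le_card_of_injOn (List.take r) ?_ ?_
    · intro L hL
      simp only [Finset.coe_filter, Set.mem_ofPred_eq, mem_lists] at hL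
      simp only [Finset.mem_coe, mem_lists, List.length_take]
      omega
    · intro L hL L' hL' h
      simp only [Finset.coe_filter, Set.mem_ofPred_eq, mem_lists] at hL hL'
      exact eq_of_rotate_eq (hL.1.trans hL'.1.symm) hL.2 hL'.2 (by omega) h
  refine (Finset.sum_le_card_nsmul _ _ _ hb).trans ?_
  rw [Nat.card_Icc, smul_eq_mul]
  exact Nat.mul_le_mul_right _ (by omega)

end Lists

/-! ### Conjugacy classes and cyclically reduced words -/

theorem isReduced_invRev {α : Type*} [DecidableEq α] {L : List (α × Bool)}
    (h : FreeGroup.IsReduced L) : FreeGroup.IsReduced (invRev L) := by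
  rw [isReduced_iff_reduce_eq, reduce_invRev, h.reduce_eq]

theorem isCyclicallyReduced_append_singleton {α : Type*} {y : α × Bool} {T : List (α × Bool)} :
    IsCyclicallyReduced (T ++ [y]) ↔ IsCyclicallyReduced (y :: T) := by
  cases T with
  | nil => rfl
  | cons t T =>
    rcases List.eq_nil_or_concat T with rfl | ⟨S, s, rfl⟩
    · simp only [IsCyclicallyReduced, FreeGroup.IsReduced, List.cons_append, List.nil_append,
        List.isChain_cons_cons, List.isChain_singleton, List.getLast?_cons_cons,
        List.getLast?_singleton, List.head?_cons, Option.mem_def, Option.some.injEq,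
        forall_eq', and_true]
      grind
    · simp only [IsCyclicallyReduced, FreeGroup.IsReduced, List.isChain_append, List.isChain_cons,
        List.concat_eq_append, List.cons_append, List.head?_cons, Option.mem_def,
        List.getLast?_append, List.getLast?_cons, List.head?_append,
        List.getLast?_nil, Option.getD_none, Option.some_or, Option.getD_some, Option.some.injEq,
        forall_eq', List.IsChain.nil]
      grind (splits := 20)

theorem IsCyclicallyReduced.rotate {α : Type*} {L : List (α × Bool)}
    (h : IsCyclicallyReduced L) (r : ℕ) : IsCyclicallyReduced (L.rotate r) := by
  induction r generalizing L with
  | zero => simpa using h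
  | succ r ih =>
    cases L with
    | nil => simp
    | cons a L =>
      rw [List.rotate_cons_succ]
      exact ih (isCyclicallyReduced_append_singleton.2 h)

theorem mk_eq_mk_of_isReduced {α : Type*} [DecidableEq α] {L L' : List (α × Bool)}
    (h : FreeGroup.IsReduced L) (h' : FreeGroup.IsReduced L')
    (e : FreeGroup.mk L = FreeGroup.mk L') : L = L' := by
  rw [← h.reduce_eq, ← h'.reduce_eq]
  exact reduce.sound e

theorem isConj_mk_append {α : Type*} (A B : List (α × Bool)) :
    IsConj (FreeGroup.mk (A ++ B)) (FreeGroup.mk (B ++ A)) := by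
  rw [isConj_iff]
  refine ⟨mk B, ?_⟩
  rw [← mul_mk, ← mul_mk]
  group

theorem isConj_mk_rotate {α : Type*} (L : List (α × Bool)) (r : ℕ) :
    IsConj (FreeGroup.mk L) (FreeGroup.mk (L.rotate r)) := by
  rw [List.rotate_eq_drop_append_take_mod]
  conv_lhs => rw [← List.take_append_drop (r % L.length) L]
  exact isConj_mk_append _ _

/-- Conjugating a cyclically reduced word by the reduced word `P` either rotates it letter by
letter or produces a reduced word starting and ending with inverse letters. -/
theorem isRotated_of_conj {α : Type*} [DecidableEq α] {L' : List (α × Bool)}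
    (hL' : IsCyclicallyReduced L') (P : List (α × Bool)) :
    ∀ L : List (α × Bool), IsCyclicallyReduced L → FreeGroup.IsReduced P →
      FreeGroup.mk P * FreeGroup.mk L * (FreeGroup.mk P)⁻¹ = FreeGroup.mk L' → L ~r L' := by
  induction P using List.reverseRecOn with
  | nil =>
    intro L hL _ h
    rw [mk_eq_mk_of_isReduced hL.isReduced hL'.isReduced (by simpa [one_eq_mk] using h)]
  | append_singleton P x ih =>
    intro L hL hP h
    have hP' : FreeGroup.IsReduced P := hP.infix ⟨[], [x], by simp⟩
    have hxinv : (FreeGroup.mk [x])⁻¹ = FreeGroup.mk [(x.1, !x.2)] := by simp [invRev]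
    by_cases h1 : ∃ T, L = (x.1, !x.2) :: T
    · obtain ⟨T, rfl⟩ := h1
      have hrot : (x.1, !x.2) :: T ~r T ++ [(x.1, !x.2)] := ⟨1, by simp⟩
      refine hrot.trans (ih _ (isCyclicallyReduced_append_singleton.2 hL) hP' ?_)
      rw [← h, ← mul_mk, ← mul_mk, ← List.singleton_append (l := T), ← mul_mk, ← hxinv]
      group
    by_cases h2 : ∃ T, L = T ++ [x]
    · obtain ⟨T, rfl⟩ := h2
      have hrot : x :: T ~r T ++ [x] := ⟨1, by simp⟩
      refine hrot.symm.trans (ih _ (isCyclicallyReduced_append_singleton.1 hL) hP' ?_)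
      rw [← h, ← mul_mk, ← mul_mk, ← List.singleton_append (l := T), ← mul_mk]
      group
    rcases List.eq_nil_or_concat L with rfl | ⟨S, s, hS⟩
    · have : FreeGroup.mk ([] : List (α × Bool)) = FreeGroup.mk L' := by
        rw [← h, ← one_eq_mk]; group
      rw [mk_eq_mk_of_isReduced hL.isReduced hL'.isReduced this]
    exfalso
    have hne : L ≠ [] := by simp [hS]
    have hinv := isReduced_invRev hP
    have hred : FreeGroup.IsReduced ((P ++ [x]) ++ L ++ invRev (P ++ [x])) := by
      rw [FreeGroup.IsReduced, List.isChain_append, List.isChain_append]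
      refine ⟨⟨hP, hL.isReduced, ?_⟩, hinv, ?_⟩
      · intro a ha b hb
        obtain ⟨y, T, rfl⟩ := List.exists_cons_of_ne_nil hne
        simp only [List.getLast?_append, List.getLast?_singleton, Option.some_or,
          Option.mem_def, Option.some.injEq, List.head?_cons] at ha hb
        subst ha hb
        intro e
        by_contra hne'
        refine h1 ⟨T, ?_⟩
        congr 1
        refine Prod.ext e.symm ?_
        revert hne'
        rcases x.2 <;> rcases y.2 <;> simp
      · intro a ha b hb
        rw [hS] at ha
        simp only [List.concat_eq_append, List.getLast?_append, List.getLast?_singleton,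
          Option.some_or, Option.mem_def, Option.some.injEq, invRev, List.map_append,
          List.map_cons, List.map_nil, List.reverse_append, List.reverse_cons,
          List.reverse_nil, List.nil_append, List.cons_append, List.head?_cons] at ha hb
        subst ha hb
        intro e
        by_contra hne'
        refine h2 ⟨S, ?_⟩
        rw [hS, List.concat_eq_append]
        congr 2
        refine Prod.ext e ?_
        revert hne'
        rcases x.2 <;> rcases s.2 <;> simp
    have e : (P ++ [x]) ++ L ++ invRev (P ++ [x]) = L' := by
      refine mk_eq_mk_of_isReduced hred hL'.isReduced ?_
      rw [← h, inv_mk, mul_mk, mul_mk]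
    obtain ⟨z, Q, hz⟩ := List.exists_cons_of_ne_nil (show P ++ [x] ≠ [] by simp)
    rw [hz] at e
    have := hL'.2 (z.1, !z.2) (by rw [← e, invRev]; simp [List.getLast?_cons]) z (by rw [← e]; simp)
    simp at this

theorem isRotated_of_isConj {α : Type*} [DecidableEq α] {L L' : List (α × Bool)}
    (hL : IsCyclicallyReduced L) (hL' : IsCyclicallyReduced L')
    (h : IsConj (FreeGroup.mk L) (FreeGroup.mk L')) :
    L ~r L' := by
  obtain ⟨c, hc⟩ := isConj_iff.1 h
  refine isRotated_of_conj hL' c.toWord L hL isReduced_toWord ?_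
  rwa [mk_toWord]

theorem reduceCyclically_eq_self {α : Type*} [DecidableEq α] {L : List (α × Bool)}
    (hL : IsCyclicallyReduced L) : reduceCyclically L = L := by
  induction L using List.bidirectionalRec with
  | nil => simp
  | singleton a => simp
  | cons_append a l b _ =>
    rw [reduceCyclically.cons_append, if_neg]
    · simp
    · rintro ⟨h1, h2⟩
      have := (isCyclicallyReduced_cons_append_iff.1 (by simpa using hL)).2 h1
      simp [this] at h2

theorem cyclicLength_mk {k : ℕ} {L : List (Fin k × Bool)} (hL : IsCyclicallyReduced L) :
    cyclicLength (FreeGroup.mk L) = L.length := by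
  rw [cyclicLength, toWord_mk, hL.isReduced.reduce_eq, reduceCyclically_eq_self hL]

open Classical in
/-- The cyclically reduced words of length `n` in `k` generators and their inverses. -/
noncomputable def cyclicWords (k n : ℕ) : Finset (List (Fin k × Bool)) :=
  (lists (Fin k × Bool) n).filter IsCyclicallyReduced

theorem mem_cyclicWords {k n : ℕ} {L : List (Fin k × Bool)} :
    L ∈ cyclicWords k n ↔ L.length = n ∧ IsCyclicallyReduced L := by
  simp [cyclicWords, mem_lists]

open Classical in
/-- The cyclically reduced words of length `n` whose vector of discrete logarithms lies in `B`. -/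
noncomputable def cyclicWordsIn {k : ℕ} (B : Set (Fin k → ℤ)) (n : ℕ) :
    Finset (List (Fin k × Bool)) :=
  (cyclicWords k n).filter fun L => logVector (FreeGroup.mk L) ∈ B

theorem mem_cyclicWordsIn {k n : ℕ} {B : Set (Fin k → ℤ)} {L : List (Fin k × Bool)} :
    L ∈ cyclicWordsIn B n ↔
      (L.length = n ∧ IsCyclicallyReduced L) ∧ logVector (FreeGroup.mk L) ∈ B := by
  simp [cyclicWordsIn, mem_cyclicWords]

open Classical in
/-- The conjugacy classes of length exactly `n` whose vector of discrete logarithms lies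
in `B`. -/
noncomputable def classesIn {k : ℕ} (B : Set (Fin k → ℤ)) (n : ℕ) :
    Finset (ConjClasses (FreeGroup (Fin k))) :=
  (cyclicWordsIn B n).image fun L => ConjClasses.mk (FreeGroup.mk L)

theorem mem_classesIn {k n : ℕ} {B : Set (Fin k → ℤ)} {c : ConjClasses (FreeGroup (Fin k))} :
    c ∈ classesIn B n ↔ classLength c = n ∧ classLogVector c ∈ B := by
  simp only [classesIn, Finset.mem_image, mem_cyclicWordsIn]
  constructor
  · rintro ⟨L, ⟨⟨rfl, hL⟩, hB⟩, rfl⟩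
    exact ⟨cyclicLength_mk hL, hB⟩
  · rintro ⟨hn, hB⟩
    obtain ⟨g, rfl⟩ := ConjClasses.exists_rep c
    obtain ⟨w, hw, hword⟩ := exists_cyclic_rep g
    refine ⟨w.toWord, ⟨⟨?_, ?_⟩, ?_⟩, ?_⟩
    · rw [hword]; exact hn
    · rw [hword]; exact reduceCyclically.isCyclicallyReduced isReduced_toWord
    · rw [mk_toWord, logVector_eq_of_isConj hw]; exact hB
    · simpa [mk_toWord] using ConjClasses.mk_eq_mk_iff_isConj.2 hw

theorem classCountIn_eq_sum {k : ℕ} (B : Set (Fin k → ℤ)) (m : ℕ) :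
    classCountIn B m = ∑ n ∈ Finset.range (m + 1), (classesIn B n).card := by
  classical
  rw [← Finset.card_biUnion, classCountIn, ← Set.ncard_coe_finset]
  · congr 1
    ext c
    simp [mem_classesIn]
  · intro a _ b _ hab
    rw [Function.onFun, Finset.disjoint_left]
    intro c hc hc'
    rw [mem_classesIn] at hc hc'
    exact hab (hc.1.symm.trans hc'.1)

theorem classCount_eq_classCountIn_univ (k m : ℕ) :
    classCount k m = classCountIn (Set.univ : Set (Fin k → ℤ)) m := by
  simp [classCount, classCountIn]

/-- A conjugacy class of length `n` contains at most `n` cyclically reduced words. -/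
theorem card_cyclicWordsIn_le {k : ℕ} (B : Set (Fin k → ℤ)) {n : ℕ} (hn : 0 < n) :
    (cyclicWordsIn B n).card ≤ n * (classesIn B n).card := by
  classical
  refine Finset.card_le_mul_card_image _ n fun c hc => ?_
  obtain ⟨L, hL, rfl⟩ := Finset.mem_image.1 hc
  rw [mem_cyclicWordsIn] at hL
  have hsub : (cyclicWordsIn B n).filter
      (fun M => ConjClasses.mk (FreeGroup.mk M) = ConjClasses.mk (FreeGroup.mk L))
      ⊆ (Finset.range n).image L.rotate := by
    intro M hM
    rw [Finset.mem_filter, mem_cyclicWordsIn, ConjClasses.mk_eq_mk_iff_isConj] at hM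
    obtain ⟨r, hr⟩ := isRotated_of_isConj hL.1.2 hM.1.1.2 hM.2.symm
    rw [Finset.mem_image]
    refine ⟨r % n, by simpa using Nat.mod_lt _ hn, ?_⟩
    rw [← hr, ← hL.1.1, List.rotate_mod]
  exact (Finset.card_le_card hsub).trans (Finset.card_image_le.trans (by simp))

/-- A conjugacy class of length `n` contains exactly `n` cyclically reduced words, unless
these words have a rotational symmetry. -/
theorem mul_card_classesIn_le {k : ℕ} (B : Set (Fin k → ℤ)) (n : ℕ) :
    n * (classesIn B n).card ≤
      (cyclicWordsIn B n).card + n * (symmetricLists (Fin k × Bool) n).card := by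
  classical
  set φ : List (Fin k × Bool) → ConjClasses (FreeGroup (Fin k)) :=
    fun L => ConjClasses.mk (FreeGroup.mk L) with hφ
  set bad := (classesIn B n).filter fun c => c ∈ (symmetricLists (Fin k × Bool) n).image φ
  set good := (classesIn B n).filter fun c => c ∉ (symmetricLists (Fin k × Bool) n).image φ
  have hsplit : (classesIn B n).card = bad.card + good.card :=
    (Finset.card_filter_add_card_filter_not
      (fun c => c ∈ (symmetricLists (Fin k × Bool) n).image φ)).symm
  have hbad : bad.card ≤ (symmetricLists (Fin k × Bool) n).card := by
    refine (Finset.card_le_card ?_).trans (Finset.card_image_le (f := φ))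
    intro c hc
    exact (Finset.mem_filter.1 hc).2
  have hgood : good.card * n ≤ (cyclicWordsIn B n).card := by
    have h1 : ∑ c ∈ good, ((cyclicWordsIn B n).filter fun L => φ L = c).card
        ≤ (cyclicWordsIn B n).card := by
      rw [Finset.card_eq_sum_card_image φ (cyclicWordsIn B n)]
      exact Finset.sum_le_sum_of_subset (Finset.filter_subset _ _)
    refine le_trans ?_ h1
    rw [← smul_eq_mul]
    refine Finset.card_nsmul_le_sum _ _ _ fun c hc => ?_
    obtain ⟨hc, hns⟩ := Finset.mem_filter.1 hc
    obtain ⟨L, hL, rfl⟩ := Finset.mem_image.1 hc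
    rw [mem_cyclicWordsIn] at hL
    have hinj : Set.InjOn L.rotate (Finset.range n) := by
      have key : ∀ i j, i < j → j < n → L.rotate i ≠ L.rotate j := by
        intro i j hij hj he
        refine hns (Finset.mem_image.2 ⟨L, ?_, rfl⟩)
        rw [symmetricLists, Finset.mem_filter, mem_lists]
        refine ⟨hL.1.1, j - i, by omega, by omega, ?_⟩
        rw [show j = (j - i) + i by omega, ← List.rotate_rotate] at he
        exact (List.rotate_injective i he).symm
      intro i hi j hj he
      simp only [Finset.coe_range, Set.mem_Iio] at hi hj
      rcases lt_trichotomy i j with h | h | h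
      · exact absurd he (key i j h hj)
      · exact h
      · exact absurd he.symm (key j i h hi)
    calc n = ((Finset.range n).image L.rotate).card := by
          rw [Finset.card_image_of_injOn hinj, Finset.card_range]
      _ ≤ _ := Finset.card_le_card ?_
    intro M hM
    obtain ⟨r, -, rfl⟩ := Finset.mem_image.1 hM
    rw [Finset.mem_filter, mem_cyclicWordsIn]
    have hconj := isConj_mk_rotate L r
    refine ⟨⟨⟨by simpa using hL.1.1, IsCyclicallyReduced.rotate hL.1.2 r⟩, ?_⟩, ?_⟩
    · rw [← logVector_eq_of_isConj hconj]; exact hL.2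
    · exact ConjClasses.mk_eq_mk_iff_isConj.2 hconj.symm
  rw [hsplit]
  nlinarith

/-! ### The trace formula for characters -/

/-- The sequence `αⁿ + βⁿ`, where `α` and `β` are the roots of `x² - A x + q`. -/
def rootPowerSum {K : Type*} [CommRing K] (A q : K) : ℕ → K
  | 0 => 2
  | 1 => A
  | n + 2 => A * rootPowerSum A q (n + 1) - q * rootPowerSum A q n

section Trace

variable {K : Type*} [CommRing K] {k : ℕ}

/-- The formal inverse of a letter. -/
def letterInv (a : Fin k × Bool) : Fin k × Bool := (a.1, !a.2)

@[simp] theorem letterInv_letterInv (a : Fin k × Bool) : letterInv (letterInv a) = a := by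
  simp [letterInv]

theorem letterInv_ne (a : Fin k × Bool) : letterInv a ≠ a := by
  intro h
  have := congrArg Prod.snd h
  simp [letterInv] at this

theorem follows_iff (a b : Fin k × Bool) : (a.1 = b.1 → a.2 = b.2) ↔ b ≠ letterInv a := by
  rcases a with ⟨i, s⟩
  rcases b with ⟨j, t⟩
  simp only [letterInv, ne_eq, Prod.mk.injEq]
  cases s <;> cases t <;> simp [eq_comm]

/-- The weighted non-backtracking transition matrix on the letters: the entry at `(a, b)` is the
weight `f b` if `b` may follow `a` in a reduced word. -/
def transitionMatrix (f : Fin k × Bool → K) : Matrix (Fin k × Bool) (Fin k × Bool) K :=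
  fun a b => if a.1 = b.1 → a.2 = b.2 then f b else 0

open Classical in
theorem transitionMatrix_pow_apply (f : Fin k × Bool → K) (n : ℕ) (a b : Fin k × Bool) :
    (transitionMatrix f ^ (n + 1)) a b = ∑ L ∈ lists (Fin k × Bool) n,
      if FreeGroup.IsReduced (a :: (L ++ [b])) then ((L ++ [b]).map f).prod else 0 := by
  induction n generalizing a with
  | zero => simp [lists, FreeGroup.IsReduced, transitionMatrix]
  | succ n ih =>
    rw [pow_succ', Matrix.mul_apply, sum_lists_succ]
    refine Finset.sum_congr rfl fun x _ => ?_
    rw [ih, Finset.mul_sum]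
    refine Finset.sum_congr rfl fun L _ => ?_
    have e : FreeGroup.IsReduced (a :: (x :: L ++ [b])) ↔
        (a.1 = x.1 → a.2 = x.2) ∧ FreeGroup.IsReduced (x :: (L ++ [b])) := by
      rw [List.cons_append, FreeGroup.IsReduced, List.isChain_cons_cons, FreeGroup.IsReduced]
    by_cases h : a.1 = x.1 → a.2 = x.2
    · by_cases h' : FreeGroup.IsReduced (x :: (L ++ [b]))
      · rw [if_pos h', if_pos (e.2 ⟨h, h'⟩), transitionMatrix, if_pos h]
        simp
      · rw [if_neg h', if_neg fun hc => h' (e.1 hc).2, mul_zero]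
    · rw [if_neg fun hc => h (e.1 hc).1, transitionMatrix, if_neg h, zero_mul]

theorem isReduced_cons_append_self {a : Fin k × Bool} {L : List (Fin k × Bool)} :
    FreeGroup.IsReduced (a :: (L ++ [a])) ↔ IsCyclicallyReduced (a :: L) := by
  rw [← List.cons_append, FreeGroup.IsReduced, List.isChain_append]
  simp [IsCyclicallyReduced, FreeGroup.IsReduced]

/-- Closed non-backtracking walks are cyclically reduced words. -/
theorem trace_transitionMatrix_pow (f : Fin k × Bool → K) (n : ℕ) :
    (transitionMatrix f ^ (n + 1)).trace = ∑ L ∈ cyclicWords k (n + 1), (L.map f).prod := by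
  classical
  rw [cyclicWords, Finset.sum_filter, sum_lists_succ, Matrix.trace]
  refine Finset.sum_congr rfl fun a _ => ?_
  rw [Matrix.diag_apply, transitionMatrix_pow_apply]
  refine Finset.sum_congr rfl fun L _ => ?_
  simp only [isReduced_cons_append_self, List.map_append, List.prod_append, List.map_cons,
    List.prod_cons, List.map_nil, List.prod_nil, mul_one]
  rw [mul_comm]

open Matrix in
/-- The Ihara-Bass formula for a bouquet of `k` circles in trace form: apart from the eigenvalues
`1` and `-1`, each of multiplicity `k - 1`, the non-backtracking matrix has the two roots of
`x² - A x + (2k - 1)` as eigenvalues, where `A` is the sum of the weights of the letters. -/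
theorem trace_transitionMatrix_pow_eq (f : Fin k × Bool → K)
    (hf : ∀ a, f a * f (letterInv a) = 1) (n : ℕ) :
    (transitionMatrix f ^ n).trace =
      rootPowerSum (∑ a, f a) (2 * k - 1) n + (k - 1) * (1 + (-1) ^ n) := by
  classical
  set A := ∑ a, f a with hA
  set B := transitionMatrix f with hB
  set u : Fin k × Bool → K := fun _ => 1 with hu
  set g : Fin k × Bool → K := fun a => f (letterInv a) with hg
  obtain ⟨Q, hQ⟩ : ∃ Q : Matrix (Fin k × Bool) (Fin k × Bool) K,
      ∀ a b, Q a b = if b = letterInv a then f b else 0 := ⟨_, fun _ _ => rfl⟩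
  have hBQ : B = vecMulVec u f - Q := by
    ext a b
    rw [Matrix.sub_apply, hQ, vecMulVec_apply]
    simp only [hB, transitionMatrix, follows_iff, hu, one_mul]
    by_cases h : b = letterInv a <;> simp [h]
  have hsumg : ∑ a, g a = A :=
    (Function.Involutive.bijective letterInv_letterInv).sum_comp f
  have hcard : ∑ _a : Fin k × Bool, (1 : K) = 2 * k := by
    simp [mul_comm]
  have hfg : f ⬝ᵥ g = 2 * k := by
    simp only [dotProduct, hg, hf, hcard]
  have hfu : f ⬝ᵥ u = A := by simp [dotProduct, hu, hA]
  have hQu : Q *ᵥ u = g := by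
    ext a
    simp [mulVec, dotProduct, hQ, hu, hg]
  have hQg : Q *ᵥ g = u := by
    ext a
    simp only [mulVec, dotProduct, hQ, hg, hu, ite_mul, zero_mul, Finset.sum_ite_eq',
      Finset.mem_univ, if_true, hf]
  have hfQ : f ᵥ* Q = u := by
    ext b
    have : ∀ a, (b = letterInv a) = (letterInv b = a) := fun a =>
      propext ⟨fun h => by rw [h, letterInv_letterInv], fun h => by rw [← h, letterInv_letterInv]⟩
    simp only [vecMul, dotProduct, hQ, hu, this, mul_ite, mul_zero, Finset.sum_ite_eq,
      Finset.mem_univ, if_true]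
    rw [mul_comm, hf]
  have hQQ : Q * Q = 1 := by
    ext a b
    simp only [mul_apply, hQ, ite_mul, zero_mul, Finset.sum_ite_eq', Finset.mem_univ, if_true,
      letterInv_letterInv, one_apply]
    by_cases h : b = a
    · rw [if_pos h, if_pos h.symm, h, mul_comm, hf]
    · rw [if_neg h, if_neg (Ne.symm h), mul_zero]
  have hBu : B *ᵥ u = A • u - g := by
    rw [hBQ, sub_mulVec, hQu, vecMulVec_mulVec, hfu]
    ext; simp
  have hBg : B *ᵥ g = (2 * k - 1 : K) • u := by
    rw [hBQ, sub_mulVec, hQg, vecMulVec_mulVec, hfg]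
    ext; simp [hu]
  -- `B = u fᵀ - Q` with `Q² = 1`, so `D = B² - 1` has its range in the span of `u` and `g`, which
  -- `B` preserves and on which `B² - A B + (2 k - 1)` vanishes
  set D := B * B - 1 with hD
  have hDeq : D = vecMulVec u (A • f - u) - vecMulVec g f := by
    rw [hD]
    nth_rw 1 [hBQ]
    rw [sub_mul, vecMulVec_mul, hBQ, mul_sub, mul_vecMulVec, hQQ, hQu, vecMul_sub, hfQ,
      vecMul_vecMulVec, hfu]
    abel
  have hBD : B * D = vecMulVec (A • u - g) (A • f - u) - (2 * k - 1 : K) • vecMulVec u f := by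
    rw [hDeq, mul_sub, mul_vecMulVec, mul_vecMulVec, hBu, hBg, smul_vecMulVec]
  have hBBD : B * (B * D) = A • (B * D) - (2 * k - 1 : K) • D := by
    rw [hBD, mul_sub, mul_smul_comm, mul_vecMulVec, mul_vecMulVec, mulVec_sub, mulVec_smul, hBu,
      hBg, hDeq]
    ext a b
    simp [vecMulVec_apply]
    ring
  have hs : ∀ n, (B ^ (n + 2) * D).trace =
      A * (B ^ (n + 1) * D).trace - (2 * k - 1) * (B ^ n * D).trace := by
    intro n
    rw [pow_add, pow_two, Matrix.mul_assoc, Matrix.mul_assoc, hBBD, mul_sub, trace_sub,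
      mul_smul_comm, mul_smul_comm, trace_smul, trace_smul, ← Matrix.mul_assoc, ← pow_succ,
      smul_eq_mul, smul_eq_mul]
  have huu : u ⬝ᵥ u = 2 * k := by simp only [dotProduct, hu, mul_one, hcard]
  have huf : u ⬝ᵥ f = A := by rw [dotProduct_comm, hfu]
  have hgf : g ⬝ᵥ f = 2 * k := by rw [dotProduct_comm, hfg]
  have hgu : g ⬝ᵥ u = A := by simp [dotProduct, hu, hsumg]
  have hp : ∀ n, (B ^ n * D).trace = rootPowerSum A (2 * k - 1) (n + 2)
      - rootPowerSum A (2 * k - 1) n := by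
    intro n
    induction n using Nat.twoStepInduction with
    | zero =>
      rw [pow_zero, one_mul, hDeq, trace_sub, trace_vecMulVec, trace_vecMulVec, dotProduct_sub,
        dotProduct_smul, huu, huf, hgf]
      simp only [rootPowerSum, smul_eq_mul]
      ring
    | one =>
      rw [pow_one, hBD, trace_sub, trace_smul, trace_vecMulVec, trace_vecMulVec, dotProduct_sub,
        sub_dotProduct, sub_dotProduct, dotProduct_smul, dotProduct_smul, smul_dotProduct,
        smul_dotProduct, huu, huf, hgf, hgu]
      simp only [rootPowerSum, smul_eq_mul]
      ring
    | more n h0 h1 =>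
      rw [hs, h0, h1]
      simp only [rootPowerSum]
      ring
  induction n using Nat.twoStepInduction with
  | zero =>
    rw [pow_zero, trace_one, rootPowerSum]
    simp
    ring
  | one =>
    have hQ0 : Q.trace = 0 := by
      refine Finset.sum_eq_zero fun a _ => ?_
      rw [diag_apply, hQ, if_neg (letterInv_ne a).symm]
    rw [pow_one, hBQ, trace_sub, trace_vecMulVec, huf, hQ0, rootPowerSum]
    ring
  | more n h0 _ =>
    have : B ^ (n + 2) = B ^ n + B ^ n * D := by
      rw [hD, mul_sub, mul_one, pow_add, pow_two]
      abel
    rw [this, trace_add, h0, hp]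
    ring

/-- The sum of a multiplicative weight over the cyclically reduced words of length `n`. -/
theorem sum_cyclicWords_prod (f : Fin k × Bool → K) (hf : ∀ a, f a * f (letterInv a) = 1)
    {n : ℕ} (hn : 0 < n) :
    ∑ L ∈ cyclicWords k n, (L.map f).prod =
      rootPowerSum (∑ a, f a) (2 * k - 1) n + (k - 1) * (1 + (-1) ^ n) := by
  obtain ⟨n, rfl⟩ := Nat.exists_eq_add_one_of_ne_zero hn.ne'
  rw [← trace_transitionMatrix_pow, trace_transitionMatrix_pow_eq f hf]

end Trace

/-! ### Bounds for the character sums -/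

theorem rootPowerSum_eq {K : Type*} [CommRing K] {α β A q : K} (hA : α + β = A) (hq : α * β = q)
    (n : ℕ) : rootPowerSum A q n = α ^ n + β ^ n := by
  induction n using Nat.twoStepInduction with
  | zero => simp [rootPowerSum]; norm_num
  | one => simp [rootPowerSum, hA]
  | more n h0 h1 =>
    rw [rootPowerSum, h0, h1, ← hA, ← hq]
    ring

theorem rootPowerSum_neg {K : Type*} [CommRing K] (A q : K) (n : ℕ) :
    rootPowerSum (-A) q n = (-1) ^ n * rootPowerSum A q n := by
  induction n using Nat.twoStepInduction with
  | zero => simp [rootPowerSum]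
  | one => simp [rootPowerSum]
  | more n h0 h1 =>
    rw [rootPowerSum, rootPowerSum, h0, h1]
    ring

theorem map_rootPowerSum {K K' : Type*} [CommRing K] [CommRing K'] (φ : K →+* K') (A q : K)
    (n : ℕ) : φ (rootPowerSum A q n) = rootPowerSum (φ A) (φ q) n := by
  induction n using Nat.twoStepInduction with
  | zero => simp only [rootPowerSum, map_ofNat]
  | one => simp [rootPowerSum]
  | more n h0 h1 => simp [rootPowerSum, h0, h1]

/-- The bound in the range of real roots. The larger root `S + √(S² - q)` is a concave function
of `S`, so it lies below its tangent at `S = k`, where it takes the value `q = 2 k - 1`. -/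
theorem abs_rootPowerSum_le_of_sq_ge {k S : ℝ} (hk : 2 ≤ k) (hS : 0 ≤ S)
    (hSq : 2 * k - 1 ≤ S ^ 2) (n : ℕ) :
    |rootPowerSum (2 * S) (2 * k - 1) n| ≤
      2 * ((2 * k - 1) ^ n * Real.exp (n * ((S - k) / (k - 1)))) := by
  set r := √(S ^ 2 - (2 * k - 1)) with hr
  have hr0 : 0 ≤ r := Real.sqrt_nonneg _
  have hr2 : r ^ 2 = S ^ 2 - (2 * k - 1) := Real.sq_sqrt (by linarith)
  have hrS : r ≤ S := by nlinarith
  have hk1 : 0 < k - 1 := by linarith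
  have hkS : 2 * k - 1 ≤ k * S := by nlinarith
  have htan : r ≤ (k - 1) + k * ((S - k) / (k - 1)) := by
    set t := (S - k) / (k - 1) with ht
    have hSt : S = k + (k - 1) * t := by rw [ht]; field_simp; ring
    have h0 : 0 ≤ (k - 1) + k * t := by
      have : (k - 1) * ((k - 1) + k * t) = k * S - (2 * k - 1) := by rw [hSt]; ring
      exact nonneg_of_mul_nonneg_right (by rw [this]; linarith) hk1
    refine abs_le_of_sq_le_sq' ?_ h0 |>.2
    rw [hr2, hSt]
    nlinarith [sq_nonneg t]
  have hα : S + r ≤ (2 * k - 1) * Real.exp ((S - k) / (k - 1)) := by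
    have h1 := Real.add_one_le_exp ((S - k) / (k - 1))
    have h2 : S = k + (k - 1) * ((S - k) / (k - 1)) := by field_simp; ring
    nlinarith
  have hpow : (S + r) ^ n ≤ (2 * k - 1) ^ n * Real.exp (n * ((S - k) / (k - 1))) := by
    rw [Real.exp_nat_mul, ← mul_pow]
    exact pow_le_pow_left₀ (by linarith) hα n
  have hβ : (S - r) ^ n ≤ (S + r) ^ n := pow_le_pow_left₀ (by linarith) (by linarith) n
  have hβ0 : 0 ≤ (S - r) ^ n := pow_nonneg (by linarith) n
  rw [rootPowerSum_eq (α := S + r) (β := S - r) (by ring) (by nlinarith),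
    abs_of_nonneg (by linarith)]
  linarith

/-- The bound in the range of complex conjugate roots. -/
theorem abs_rootPowerSum_le_of_sq_lt {q S : ℝ} (hSq : S ^ 2 ≤ q) (n : ℕ) :
    |rootPowerSum (2 * S) q n| ≤ 2 * √q ^ n := by
  set r := √(q - S ^ 2) with hr
  have hr2 : r ^ 2 = q - S ^ 2 := Real.sq_sqrt (by linarith)
  have hnorm : ‖(⟨S, r⟩ : ℂ)‖ = √q := by
    rw [Complex.norm_def, Complex.normSq_mk]
    congr 1
    nlinarith
  have hnorm' : ‖(⟨S, -r⟩ : ℂ)‖ = √q := by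
    rw [Complex.norm_def, Complex.normSq_mk]
    congr 1
    nlinarith
  have h : ((rootPowerSum (2 * S) q n : ℝ) : ℂ) = (⟨S, r⟩ : ℂ) ^ n + (⟨S, -r⟩ : ℂ) ^ n := by
    rw [← rootPowerSum_eq (A := ((2 * S : ℝ) : ℂ)) (q := (q : ℂ))]
    · exact map_rootPowerSum Complex.ofRealHom _ _ n
    · apply Complex.ext <;> simp; ring
    · apply Complex.ext <;> simp <;> nlinarith
  rw [← Real.norm_eq_abs, ← Complex.norm_real, h]
  refine (norm_add_le _ _).trans ?_
  rw [norm_pow, norm_pow, hnorm, hnorm', two_mul]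

/-- The sum of a character over the cyclically reduced words of length `n` in `k` generators,
when half the sum of the character over all letters equals `S`. -/
noncomputable def wordSum (k : ℕ) (n : ℕ) (S : ℝ) : ℝ :=
  rootPowerSum (2 * S) (2 * k - 1) n + (k - 1) * (1 + (-1) ^ n)

theorem abs_correction_le {k : ℕ} (hk : 2 ≤ k) (n : ℕ) :
    |((k : ℝ) - 1) * (1 + (-1) ^ n)| ≤ 2 * (k - 1) := by
  have : (2 : ℝ) ≤ k := by exact_mod_cast hk
  rw [abs_mul, abs_of_nonneg (by linarith), mul_comm]
  refine mul_le_mul_of_nonneg_right ?_ (by linarith)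
  rcases neg_one_pow_eq_or ℝ n with h | h <;> rw [h] <;> norm_num

theorem exp_quarter_le_sqrt {k : ℝ} (hk : 2 ≤ k) : Real.exp (1 / 4) ≤ √(2 * k - 1) := by
  refine Real.le_sqrt_of_sq_le ?_
  rw [← Real.exp_nat_mul]
  have h1 : Real.exp (((2 : ℕ) : ℝ) * (1 / 4)) ≤ Real.exp 1 := Real.exp_le_exp.2 (by norm_num)
  have := Real.exp_one_lt_d9
  linarith

/-- Exponential decay of character sums away from the two extremal values `S = ± k`. -/
theorem abs_wordSum_le {k : ℕ} (hk : 2 ≤ k) {S : ℝ} (hS : |S| ≤ k) (n : ℕ) :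
    |wordSum k n S| ≤ 2 * k * ((2 * k - 1) ^ n * Real.exp (-(n * ((k - |S|) / (4 * k))))) := by
  have hk' : (2 : ℝ) ≤ k := by exact_mod_cast hk
  -- the constant `4` is large enough for the bound to dominate `√q ^ n`, the growth in the range
  -- of complex roots, because `exp (1 / 4) ≤ √3 ≤ √q`
  set q : ℝ := 2 * k - 1 with hq
  have hq3 : 3 ≤ q := by linarith
  have hquarter := exp_quarter_le_sqrt hk'
  rw [← hq] at hquarter
  have hsq : √q * √q = q := Real.mul_self_sqrt (by linarith)
  have hkS : (k - |S|) / (4 * k) ≤ 1 / 4 := by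
    rw [div_le_div_iff₀ (by linarith) (by norm_num)]
    linarith [abs_nonneg S]
  have hlow : √q ≤ q * Real.exp (-((k - |S|) / (4 * k))) := by
    have h1 : Real.exp (-(1 / 4)) ≤ Real.exp (-((k - |S|) / (4 * k))) :=
      Real.exp_le_exp.2 (by linarith)
    have h2 : Real.exp (1 / 4) * Real.exp (-(1 / 4)) = 1 := by rw [← Real.exp_add]; simp
    have h3 : 1 ≤ √q * Real.exp (-(1 / 4)) := by
      exact h2.symm.le.trans (mul_le_mul_of_nonneg_right hquarter (Real.exp_pos _).le)
    calc √q = √q * 1 := by ring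
      _ ≤ √q * (√q * Real.exp (-(1 / 4))) := by gcongr
      _ = q * Real.exp (-(1 / 4)) := by rw [← mul_assoc, hsq]
      _ ≤ _ := by gcongr
  have hE : q ^ n * Real.exp (-(n * ((k - |S|) / (4 * k)))) =
      (q * Real.exp (-((k - |S|) / (4 * k)))) ^ n := by
    rw [mul_pow, ← Real.exp_nat_mul]; ring_nf
  have hone : 1 ≤ q ^ n * Real.exp (-(n * ((k - |S|) / (4 * k)))) := by
    rw [hE]
    refine one_le_pow₀ (le_trans ?_ hlow)
    rw [Real.one_le_sqrt]; linarith
  have hmain : |rootPowerSum (2 * S) q n| ≤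
      2 * (q ^ n * Real.exp (-(n * ((k - |S|) / (4 * k))))) := by
    have habs : |rootPowerSum (2 * S) q n| = |rootPowerSum (2 * |S|) q n| := by
      rcases abs_choice S with h | h
      · rw [h]
      · rw [h, mul_neg, rootPowerSum_neg, abs_mul]; simp
    rw [habs]
    rcases le_total q (|S| ^ 2) with h | h
    · refine (abs_rootPowerSum_le_of_sq_ge hk' (abs_nonneg S) h n).trans ?_
      gcongr
      rw [← mul_neg]
      gcongr
      have h1 : (k - |S|) / (4 * k) ≤ (k - |S|) / ((k : ℝ) - 1) :=
        div_le_div_of_nonneg_left (by linarith) (by linarith) (by linarith)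
      have h2 : (|S| - k) / ((k : ℝ) - 1) = -((k - |S|) / (k - 1)) := by ring
      linarith
    · refine (abs_rootPowerSum_le_of_sq_lt h n).trans ?_
      rw [hE]
      gcongr
  have hcorr := abs_correction_le hk n
  rw [wordSum]
  refine (abs_add_le _ _).trans ?_
  nlinarith

/-- Growth of character sums beyond the value `S = k` of the trivial character. -/
theorem abs_wordSum_le_of_ge {k : ℕ} (hk : 2 ≤ k) {S : ℝ} (hS : k ≤ S) (n : ℕ) :
    |wordSum k n S| ≤ 2 * k * ((2 * k - 1) ^ n * Real.exp (n * ((S - k) / (k - 1)))) := by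
  have hk' : (2 : ℝ) ≤ k := by exact_mod_cast hk
  have h1 := abs_rootPowerSum_le_of_sq_ge hk' (by linarith) (by nlinarith) n (S := S)
  have h2 := abs_correction_le hk n
  have h3 : 1 ≤ (2 * (k : ℝ) - 1) ^ n * Real.exp (n * ((S - k) / (k - 1))) := by
    refine one_le_mul_of_one_le_of_one_le (one_le_pow₀ (by linarith)) (Real.one_le_exp ?_)
    exact mul_nonneg n.cast_nonneg (div_nonneg (by linarith) (by linarith))
  rw [wordSum]
  refine (abs_add_le _ _).trans ?_
  nlinarith

theorem wordSum_self (k n : ℕ) :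
    wordSum k n k = (2 * k - 1) ^ n + 1 + (k - 1) * (1 + (-1) ^ n) := by
  rw [wordSum, rootPowerSum_eq (α := 2 * (k : ℝ) - 1) (β := 1) (by ring) (by ring), one_pow]

theorem wordSum_neg_self (k n : ℕ) :
    wordSum k n (-k) = (-1) ^ n * ((2 * k - 1) ^ n + 1) + (k - 1) * (1 + (-1) ^ n) := by
  rw [wordSum, mul_neg, rootPowerSum_neg,
    rootPowerSum_eq (α := 2 * (k : ℝ) - 1) (β := 1) (by ring) (by ring), one_pow]

/-! ### Characters and counts of words -/

theorem lift_eq_prod_zpow {k : ℕ} {G : Type*} [CommGroup G] (z : Fin k → G)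
    (g : FreeGroup (Fin k)) : FreeGroup.lift z g = ∏ j, z j ^ logVector g j := by
  have h : FreeGroup.lift z = ∏ j, (zpowersHom G (z j)).comp (discreteLog j) := by
    ext i
    simp only [FreeGroup.lift_apply_of, MonoidHom.finsetProd_apply, MonoidHom.comp_apply,
      discreteLog, zpowersHom_apply, toAdd_ofAdd]
    rw [Finset.prod_eq_single i]
    · simp
    · intro j _ hj
      simp [Ne.symm hj]
    · simp
  rw [h]
  simp [MonoidHom.finsetProd_apply, logVector]

/-- The trace formula for a character of the free group, given by its values `z` on the
generators. -/
theorem sum_cyclicWords_character {K : Type*} [CommRing K] {k : ℕ} (z : Fin k → Kˣ) {n : ℕ}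
    (hn : 0 < n) :
    ∑ L ∈ cyclicWords k n, ((∏ j, z j ^ logVector (FreeGroup.mk L) j : Kˣ) : K) =
      rootPowerSum (∑ j, ((z j : K) + ((z j)⁻¹ : Kˣ))) (2 * k - 1) n
        + (k - 1) * (1 + (-1) ^ n) := by
  set f : Fin k × Bool → K := fun l => ((if l.2 then z l.1 else (z l.1)⁻¹ : Kˣ) : K) with hf
  have hinv : ∀ a, f a * f (letterInv a) = 1 := by
    rintro ⟨i, s⟩
    cases s <;> simp [hf, letterInv]
  have hA : ∑ a, f a = ∑ j, ((z j : K) + ((z j)⁻¹ : Kˣ)) := by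
    rw [Fintype.sum_prod_type]
    simp [hf]
  rw [← hA, ← sum_cyclicWords_prod f hinv hn]
  refine Finset.sum_congr rfl fun L _ => ?_
  rw [← lift_eq_prod_zpow, FreeGroup.lift_mk, ← Units.coeHom_apply, map_list_prod, List.map_map]
  congr 1
  refine List.map_congr_left fun l _ => ?_
  rcases l with ⟨i, s⟩
  cases s <;> simp [hf]

theorem card_cyclicWords {k n : ℕ} (hn : 0 < n) :
    ((cyclicWords k n).card : ℝ) = (2 * k - 1) ^ n + 1 + (k - 1) * (1 + (-1) ^ n) := by
  have h := sum_cyclicWords_character (K := ℝ) (k := k) (fun _ => 1) hn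
  simp only [one_zpow, Finset.prod_const_one, Units.val_one, Finset.sum_const, nsmul_eq_mul,
    mul_one, inv_one, Finset.card_univ, Fintype.card_fin] at h
  rw [h, rootPowerSum_eq (α := 2 * (k : ℝ) - 1) (β := 1) (by ring) (by ring), one_pow]

theorem sum_cyclicWords_exp {k n : ℕ} (hn : 0 < n) (i : Fin k) (s : ℝ) :
    ∑ L ∈ cyclicWords k n, Real.exp (s * logVector (FreeGroup.mk L) i) =
      wordSum k n (k + (Real.cosh s - 1)) := by
  have h := sum_cyclicWords_character (K := ℝ) (k := k)
    (fun j => Units.mk0 (Real.exp (if j = i then s else 0)) (Real.exp_ne_zero _)) hn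
  have hsum : ∑ j : Fin k, (Real.exp (if j = i then s else 0) + Real.exp (-if j = i then s else 0))
      = 2 * (k + (Real.cosh s - 1)) := by
    have : ∀ j : Fin k, Real.exp (if j = i then s else 0) + Real.exp (-if j = i then s else 0)
        = 2 + if j = i then 2 * (Real.cosh s - 1) else 0 := by
      intro j
      by_cases hj : j = i
      · simp only [hj, if_true, Real.cosh_eq]; ring
      · simp only [hj, if_false, neg_zero, Real.exp_zero]; norm_num
    simp only [this, Finset.sum_add_distrib, Finset.sum_ite_eq', Finset.mem_univ, if_true,
      Finset.sum_const, Finset.card_univ, Fintype.card_fin, nsmul_eq_mul]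
    ring
  simp only [Units.val_mk0, Units.val_inv_eq_inv_val, ← Real.exp_neg, hsum] at h
  rw [wordSum, ← h]
  refine Finset.sum_congr rfl fun L _ => ?_
  rw [Units.coe_prod, Finset.prod_eq_single i]
  · rw [Units.val_zpow_eq_zpow_val, Units.val_mk0, if_pos rfl, Real.exp_mul, Real.rpow_intCast]
  · intro j _ hj
    simp [hj]
  · simp

/-- The points whose coordinates are all divisible by `d`. -/
def divisiblePoints (k d : ℕ) : Set (Fin k → ℤ) := {v | ∀ j, (d : ℤ) ∣ v j}

/-- The value at `a` of the cosine with period `d`. -/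
noncomputable def cosMod (d : ℕ) [NeZero d] (a : ZMod d) : ℝ := (ZMod.stdAddChar a).re

theorem norm_stdAddChar {d : ℕ} [NeZero d] (a : ZMod d) : ‖(ZMod.stdAddChar a : ℂ)‖ = 1 := by
  exact Circle.norm_coe _

theorem stdAddChar_add_inv {d : ℕ} [NeZero d] (a : ZMod d) :
    (ZMod.stdAddChar a : ℂ) + (ZMod.stdAddChar a)⁻¹ = ((2 * cosMod d a : ℝ) : ℂ) := by
  rw [Complex.inv_eq_conj (norm_stdAddChar a), Complex.add_conj, cosMod]

theorem abs_cosMod_le_one {d : ℕ} [NeZero d] (a : ZMod d) : |cosMod d a| ≤ 1 := by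
  rw [cosMod, ← norm_stdAddChar a]
  exact Complex.abs_re_le_norm _

theorem cosMod_eq_one_iff {d : ℕ} [NeZero d] {a : ZMod d} : cosMod d a = 1 ↔ a = 0 := by
  constructor
  · intro h
    refine ZMod.injective_stdAddChar ?_
    rw [AddChar.map_zero_eq_one]
    have hn := norm_stdAddChar a
    rw [← sq_eq_sq₀ (norm_nonneg _) zero_le_one, Complex.sq_norm, Complex.normSq_apply] at hn
    rw [cosMod] at h
    refine Complex.ext h ?_
    rw [h] at hn
    simp only [Complex.one_im]
    nlinarith
  · rintro rfl
    simp [cosMod]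

/-- Counting words whose exponent sums are divisible by `d` by summing over the characters
modulo `d`. -/
theorem pow_mul_card_divisible {k n d : ℕ} [NeZero d] (hn : 0 < n) :
    (d : ℝ) ^ k * (cyclicWordsIn (divisiblePoints k d) n).card =
      ∑ a : Fin k → ZMod d, wordSum k n (∑ j, cosMod d (a j)) := by
  classical
  apply Complex.ofReal_injective
  push_cast
  have hchar : ∀ a : Fin k → ZMod d, ((wordSum k n (∑ j, cosMod d (a j)) : ℝ) : ℂ) =
      ∑ L ∈ cyclicWords k n,
        ∏ j, ZMod.stdAddChar (a j * (logVector (FreeGroup.mk L) j : ZMod d)) := by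
    intro a
    have h := sum_cyclicWords_character (K := ℂ) (k := k)
      (fun j => Units.mk0 (ZMod.stdAddChar (a j))
        (norm_ne_zero_iff.1 (by rw [norm_stdAddChar]; exact one_ne_zero))) hn
    simp only [Units.val_mk0, Units.val_inv_eq_inv_val, stdAddChar_add_inv] at h
    rw [wordSum, Complex.ofReal_add]
    have hr := map_rootPowerSum Complex.ofRealHom (2 * ∑ j, cosMod d (a j)) (2 * k - 1) n
    simp only [Complex.ofRealHom_eq_coe] at hr
    rw [hr]
    have e1 : (((2 * ∑ j, cosMod d (a j)) : ℝ) : ℂ) = ∑ j, ((2 * cosMod d (a j) : ℝ) : ℂ) := by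
      rw [Finset.mul_sum, Complex.ofReal_sum]
    rw [e1]
    push_cast at h ⊢
    rw [← h]
    refine Finset.sum_congr rfl fun L _ => Finset.prod_congr rfl fun j _ => ?_
    rw [Units.val_mk0, ← AddChar.map_zsmul_eq_zpow, zsmul_eq_mul, mul_comm]
  simp only [hchar]
  rw [Finset.sum_comm]
  have horth : ∀ L : List (Fin k × Bool),
      ∑ a : Fin k → ZMod d, ∏ j, ZMod.stdAddChar (a j * (logVector (FreeGroup.mk L) j : ZMod d)) =
        if logVector (FreeGroup.mk L) ∈ divisiblePoints k d then (d : ℂ) ^ k else 0 := by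
    intro L
    have := Finset.prod_univ_sum (fun _ : Fin k => (Finset.univ : Finset (ZMod d)))
      (fun j x => (ZMod.stdAddChar (x * (logVector (FreeGroup.mk L) j : ZMod d)) : ℂ))
    rw [Fintype.piFinset_univ] at this
    rw [← this]
    simp only [AddChar.sum_mulShift _ (ZMod.isPrimitive_stdAddChar d), ZMod.card,
      ZMod.intCast_zmod_eq_zero_iff_dvd]
    split_ifs with h
    · have h' : ∀ j, (d : ℤ) ∣ logVector (FreeGroup.mk L) j := h
      simp [h']
    · have h' : ¬ ∀ j, (d : ℤ) ∣ logVector (FreeGroup.mk L) j := h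
      push Not at h'
      obtain ⟨j, hj⟩ := h'
      exact Finset.prod_eq_zero (Finset.mem_univ j) (by simp [hj])
  simp only [horth]
  rw [cyclicWordsIn, ← Finset.sum_filter, Finset.sum_const, nsmul_eq_mul, mul_comm]

/-! ### Frequencies of divisibility conditions and of large exponent sums -/

/-- The number of cyclically reduced words of length `n` with exponent sums in `B`, relative to
`(2 k - 1) ^ n`, which is asymptotically the number of all of them. -/
noncomputable def wordFrequency {k : ℕ} (B : Set (Fin k → ℤ)) (n : ℕ) : ℝ :=
  (cyclicWordsIn B n).card / (2 * k - 1) ^ n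

theorem tendsto_inv_pow_zero {k : ℕ} (hk : 2 ≤ k) :
    Tendsto (fun n : ℕ => ((2 * (k : ℝ) - 1)⁻¹) ^ n) atTop (𝓝 0) := by
  have hk' : (2 : ℝ) ≤ k := by exact_mod_cast hk
  exact tendsto_pow_atTop_nhds_zero_of_lt_one (inv_nonneg.2 (by linarith))
    (inv_lt_one_of_one_lt₀ (by linarith))

theorem tendsto_wordSum_self {k : ℕ} (hk : 2 ≤ k) :
    Tendsto (fun n => wordSum k n k / (2 * k - 1) ^ n) atTop (𝓝 1) := by
  have hk' : (2 : ℝ) ≤ k := by exact_mod_cast hk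
  have h0 := (tendsto_inv_pow_zero hk).const_mul (1 + 2 * ((k : ℝ) - 1))
  rw [mul_zero] at h0
  rw [← tendsto_sub_nhds_zero_iff]
  refine squeeze_zero_norm (fun n => ?_) h0
  have hq : (2 * (k : ℝ) - 1) ^ n ≠ 0 := pow_ne_zero _ (by linarith)
  have e : wordSum k n k / (2 * k - 1) ^ n - 1 =
      (1 + (k - 1) * (1 + (-1) ^ n)) * ((2 * (k : ℝ) - 1)⁻¹) ^ n := by
    rw [wordSum_self, inv_pow]
    field_simp
    ring
  rw [e, Real.norm_eq_abs, abs_mul, abs_of_nonneg (a := _ ^ n) (pow_nonneg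
    (inv_nonneg.2 (by linarith)) n)]
  refine mul_le_mul_of_nonneg_right ?_ (pow_nonneg (inv_nonneg.2 (by linarith)) n)
  refine (abs_add_le _ _).trans ?_
  rw [abs_one]
  linarith [abs_correction_le hk n]

theorem tendsto_wordSum_neg_self {k : ℕ} (hk : 2 ≤ k) :
    Tendsto (fun n => wordSum k n (-k) / (2 * k - 1) ^ n - (-1) ^ n) atTop (𝓝 0) := by
  have hk' : (2 : ℝ) ≤ k := by exact_mod_cast hk
  have h0 := (tendsto_inv_pow_zero hk).const_mul (1 + 2 * ((k : ℝ) - 1))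
  rw [mul_zero] at h0
  refine squeeze_zero_norm (fun n => ?_) h0
  have hq : (2 * (k : ℝ) - 1) ^ n ≠ 0 := pow_ne_zero _ (by linarith)
  have e : wordSum k n (-k) / (2 * k - 1) ^ n - (-1) ^ n =
      ((-1) ^ n + (k - 1) * (1 + (-1) ^ n)) * ((2 * (k : ℝ) - 1)⁻¹) ^ n := by
    rw [wordSum_neg_self, inv_pow]
    field_simp
    ring
  rw [e, Real.norm_eq_abs, abs_mul, abs_of_nonneg (a := _ ^ n) (pow_nonneg
    (inv_nonneg.2 (by linarith)) n)]
  refine mul_le_mul_of_nonneg_right ?_ (pow_nonneg (inv_nonneg.2 (by linarith)) n)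
  refine (abs_add_le _ _).trans ?_
  rw [abs_pow, abs_neg, abs_one, one_pow]
  linarith [abs_correction_le hk n]

theorem tendsto_wordSum_zero {k : ℕ} (hk : 2 ≤ k) {S : ℝ} (hS : |S| < k) :
    Tendsto (fun n => wordSum k n S / (2 * k - 1) ^ n) atTop (𝓝 0) := by
  have hk' : (2 : ℝ) ≤ k := by exact_mod_cast hk
  have hr : Real.exp (-((k - |S|) / (4 * k))) < 1 := by
    rw [Real.exp_lt_one_iff, neg_lt_zero]
    exact div_pos (by linarith) (by linarith)
  have h0 := (tendsto_pow_atTop_nhds_zero_of_lt_one (Real.exp_pos _).le hr).const_mul (2 * (k : ℝ))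
  rw [mul_zero] at h0
  refine squeeze_zero_norm (fun n => ?_) h0
  have hq : 0 < (2 * (k : ℝ) - 1) ^ n := pow_pos (by linarith) n
  rw [norm_div, Real.norm_eq_abs, Real.norm_of_nonneg hq.le, div_le_iff₀ hq, ← Real.exp_nat_mul]
  refine (abs_wordSum_le hk hS.le n).trans_eq ?_
  rw [mul_neg]
  ring

/-- Averaging over two consecutive lengths removes the contribution of the parity character,
for which `S = -k`. -/
theorem tendsto_wordSum_add_wordSum {k : ℕ} (hk : 2 ≤ k) {S : ℝ} (hS : |S| ≤ k) :
    Tendsto (fun n => wordSum k n S / (2 * k - 1) ^ n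
      + wordSum k (n + 1) S / (2 * k - 1) ^ (n + 1)) atTop (𝓝 (if S = k then 2 else 0)) := by
  have hk' : (2 : ℝ) ≤ k := by exact_mod_cast hk
  by_cases h1 : S = k
  · subst h1
    have h := tendsto_wordSum_self hk
    have h' := h.add (h.comp (tendsto_add_atTop_nat 1))
    rw [one_add_one_eq_two] at h'
    rwa [if_pos rfl]
  rw [if_neg h1]
  by_cases h2 : S = -k
  · subst h2
    have h := tendsto_wordSum_neg_self hk
    have h' := h.add (h.comp (tendsto_add_atTop_nat 1))
    rw [add_zero] at h'
    refine h'.congr fun n => ?_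
    simp only [Function.comp_apply, pow_succ (-1 : ℝ)]
    ring
  · have hlt : |S| < k := lt_of_le_of_ne hS fun h => by
      rcases (abs_eq (by linarith)).1 h with h | h
      · exact h1 h
      · exact h2 h
    have h := tendsto_wordSum_zero hk hlt
    rw [← add_zero (0 : ℝ)]
    exact h.add (h.comp (tendsto_add_atTop_nat 1))

theorem abs_sum_cosMod_le {k d : ℕ} [NeZero d] (a : Fin k → ZMod d) :
    |∑ j, cosMod d (a j)| ≤ k := by
  refine (Finset.abs_sum_le_sum_abs _ _).trans ?_
  refine (Finset.sum_le_card_nsmul _ _ 1 fun j _ => abs_cosMod_le_one (a j)).trans ?_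
  simp

theorem sum_cosMod_eq_iff {k d : ℕ} [NeZero d] (a : Fin k → ZMod d) :
    ∑ j, cosMod d (a j) = k ↔ a = 0 := by
  have h : ∑ j, cosMod d (a j) = k ↔ ∀ j, cosMod d (a j) = 1 := by
    have hk : (k : ℝ) = ∑ _j : Fin k, (1 : ℝ) := by simp
    rw [hk, Finset.sum_eq_sum_iff_of_le fun j _ => (abs_le.1 (abs_cosMod_le_one (a j))).2]
    simp
  rw [h, funext_iff]
  simp only [cosMod_eq_one_iff, Pi.zero_apply]

theorem wordFrequency_divisible {k d : ℕ} [NeZero d] {n : ℕ} (hn : 0 < n) :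
    wordFrequency (divisiblePoints k d) n =
      (∑ a : Fin k → ZMod d, wordSum k n (∑ j, cosMod d (a j)) / (2 * k - 1) ^ n) / d ^ k := by
  have hd : (d : ℝ) ^ k ≠ 0 := pow_ne_zero _ (Nat.cast_ne_zero.2 (NeZero.ne d))
  rw [← Finset.sum_div, ← pow_mul_card_divisible hn, wordFrequency]
  field_simp

/-- Divisibility by `d` has the expected frequency on average over two consecutive lengths. -/
theorem tendsto_wordFrequency_divisible {k : ℕ} (hk : 2 ≤ k) {d : ℕ} (hd : 0 < d) :
    Tendsto (fun n => wordFrequency (divisiblePoints k d) n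
      + wordFrequency (divisiblePoints k d) (n + 1)) atTop (𝓝 (2 / d ^ k)) := by
  classical
  have : NeZero d := ⟨hd.ne'⟩
  have h := tendsto_finsetSum (Finset.univ : Finset (Fin k → ZMod d)) fun a _ =>
    tendsto_wordSum_add_wordSum hk (abs_sum_cosMod_le a)
  have h' := h.div_const ((d : ℝ) ^ k)
  have e : ∑ a : Fin k → ZMod d, (if ∑ j, cosMod d (a j) = (k : ℝ) then (2 : ℝ) else 0) = 2 := by
    simp only [sum_cosMod_eq_iff, Finset.sum_ite_eq', Finset.mem_univ, if_true]
  rw [e] at h'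
  refine h'.congr' ?_
  filter_upwards [eventually_gt_atTop 0] with n hn
  rw [wordFrequency_divisible hn, wordFrequency_divisible n.succ_pos, Finset.sum_add_distrib,
    add_div]

/-- Jordan's inequality for the sine of period `d`, doubled. -/
theorem four_mul_sq_le_sq_mul_sin_sq {d : ℕ} (hd : 0 < d) {a : ℕ} (ha : a < d) :
    ∃ i ∈ Finset.range 3, 4 * ((2 * (a : ℤ) - i * d : ℤ) : ℝ) ^ 2 ≤
      (d : ℝ) ^ 2 * Real.sin (2 * Real.pi * a / d) ^ 2 := by
  have hd' : (0 : ℝ) < d := by exact_mod_cast hd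
  have ha' : (a : ℝ) < d := by exact_mod_cast ha
  set y : ℝ := 2 * a / d with hy
  set m : ℤ := round y with hm
  have hround := abs_sub_round y
  rw [← hm] at hround
  have hy0 : 0 ≤ y := by positivity
  have hy2 : y < 2 := by rw [hy, div_lt_iff₀ hd']; linarith
  have hm0 : 0 ≤ m := by
    have h1 : (-1 : ℝ) < m := by linarith [(abs_le.1 hround).2]
    have : -1 < m := by exact_mod_cast h1
    omega
  have hm3 : m < 3 := by
    have h1 : (m : ℝ) < 3 := by linarith [(abs_le.1 hround).1]
    exact_mod_cast h1
  refine ⟨m.toNat, Finset.mem_range.2 (by omega), ?_⟩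
  have hcast : ((m.toNat : ℕ) : ℤ) = m := Int.toNat_of_nonneg hm0
  have hsin : |Real.sin (2 * Real.pi * a / d)| = |Real.sin (Real.pi * (y - m))| := by
    have e : 2 * Real.pi * a / d = Real.pi * (y - m) + m * Real.pi := by
      rw [hy]; field_simp; ring
    rw [e, Real.sin_add_int_mul_pi, abs_mul, abs_zpow, abs_neg, abs_one, one_zpow, one_mul]
  have hj : 2 * |y - m| ≤ |Real.sin (Real.pi * (y - m))| := by
    have h1 := Real.mul_abs_le_abs_sin (x := Real.pi * (y - m)) (by
      rw [abs_mul, abs_of_pos Real.pi_pos]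
      nlinarith [Real.pi_pos])
    rw [abs_mul, abs_of_pos Real.pi_pos] at h1
    refine le_trans (le_of_eq ?_) h1
    field_simp
  have e2 : ((2 * (a : ℤ) - m * d : ℤ) : ℝ) = d * (y - m) := by
    rw [hy]; push_cast; field_simp
  rw [hcast, e2, ← sq_abs (Real.sin _), hsin]
  calc 4 * (d * (y - m)) ^ 2 = (d : ℝ) ^ 2 * (2 * |y - m|) ^ 2 := by
        rw [mul_pow, mul_pow, sq_abs]; ring
    _ ≤ _ := by gcongr

theorem one_sub_cosMod_sq {d : ℕ} [NeZero d] (a : ZMod d) :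
    1 - cosMod d a ^ 2 = Real.sin (2 * Real.pi * a.val / d) ^ 2 := by
  have h : cosMod d a = Real.cos (2 * Real.pi * a.val / d) := by
    have h1 := ZMod.stdAddChar_coe (N := d) (a.val : ℤ)
    rw [Int.cast_natCast, ZMod.natCast_zmod_val] at h1
    rw [cosMod, h1]
    have e : (2 * Real.pi * Complex.I * ((a.val : ℤ) : ℂ) / d : ℂ) =
        ((2 * Real.pi * a.val / d : ℝ) : ℂ) * Complex.I := by
      push_cast; ring
    rw [e, Complex.exp_ofReal_mul_I_re]
  rw [h, Real.sin_sq]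

theorem summable_exp_neg_mul_abs {κ : ℝ} (hκ : 0 < κ) :
    Summable fun z : ℤ => Real.exp (-(κ * |(z : ℝ)|)) := by
  have h : Summable fun n : ℕ => Real.exp (-(κ * n)) := by
    have := summable_geometric_of_lt_one (Real.exp_pos (-κ)).le (by simpa using hκ)
    refine this.congr fun n => ?_
    rw [← Real.exp_nat_mul]; ring_nf
  rw [summable_int_iff_summable_nat_and_neg]
  constructor <;> simpa using h

/-- The sum over the characters modulo `d` is bounded independently of `d`. -/
theorem sum_exp_neg_mul_le {κ : ℝ} (hκ : 0 < κ) (d : ℕ) [NeZero d] :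
    ∑ a : ZMod d, Real.exp (-(κ * (d ^ 2 * (1 - cosMod d a ^ 2)))) ≤
      3 * ∑' z : ℤ, Real.exp (-(4 * κ * |(z : ℝ)|)) := by
  have hd : 0 < d := Nat.pos_of_ne_zero (NeZero.ne d)
  have hs := summable_exp_neg_mul_abs (κ := 4 * κ) (by linarith)
  set F : ℤ → ℝ := fun z => Real.exp (-(4 * κ * |(z : ℝ)|)) with hF
  have hpt : ∀ a : ZMod d, Real.exp (-(κ * (d ^ 2 * (1 - cosMod d a ^ 2)))) ≤
      ∑ i ∈ Finset.range 3, F (2 * (a.val : ℤ) - i * d) := by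
    intro a
    obtain ⟨i, hi, hle⟩ := four_mul_sq_le_sq_mul_sin_sq hd (ZMod.val_lt a)
    refine le_trans ?_ (Finset.single_le_sum (f := fun i : ℕ => F (2 * (a.val : ℤ) - i * d))
      (fun j _ => (Real.exp_pos _).le) hi)
    rw [one_sub_cosMod_sq]
    refine Real.exp_le_exp.2 (neg_le_neg ?_)
    set z : ℤ := 2 * (a.val : ℤ) - i * d with hz
    have habs : |(z : ℝ)| ≤ (z : ℝ) ^ 2 := by
      rw [← sq_abs, ← Int.cast_abs]
      exact_mod_cast Int.le_self_sq |z|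
    nlinarith
  refine (Finset.sum_le_sum fun a _ => hpt a).trans ?_
  rw [Finset.sum_comm]
  refine (Finset.sum_le_card_nsmul _ _ (∑' z, F z) fun i _ => ?_).trans_eq (by simp)
  have hinj : Function.Injective fun a : ZMod d => 2 * (a.val : ℤ) - i * d := by
    intro a b h
    refine ZMod.val_injective d ?_
    simp only at h
    omega
  have := hs.sum_le_tsum (Finset.univ.map ⟨_, hinj⟩) fun z _ => (Real.exp_pos _).le
  rwa [Finset.sum_map] at this

/-- Uniformly for `d ≤ R √n`, the frequency of divisibility by `d` is at most of the expected
order of magnitude. -/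
theorem exists_wordFrequency_divisible_le {k : ℕ} (hk : 2 ≤ k) {R : ℝ} (hR : 0 < R) :
    ∃ C : ℝ, 0 ≤ C ∧ ∀ n d : ℕ, 0 < n → 0 < d → (d : ℝ) ≤ R * √n →
      wordFrequency (divisiblePoints k d) n ≤ C * ((d : ℝ) ^ 2)⁻¹ := by
  have hk' : (2 : ℝ) ≤ k := by exact_mod_cast hk
  set κ : ℝ := 1 / (8 * k * R ^ 2) with hκdef
  have hκ : 0 < κ := by positivity
  set G : ℝ := 3 * ∑' z : ℤ, Real.exp (-(4 * κ * |(z : ℝ)|)) with hG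
  have hG0 : 0 ≤ G := mul_nonneg (by norm_num) (tsum_nonneg fun z => (Real.exp_pos _).le)
  refine ⟨2 * k * G ^ k, by positivity, fun n d hn hd hdR => ?_⟩
  have : NeZero d := ⟨hd.ne'⟩
  have hd1 : (1 : ℝ) ≤ d := by exact_mod_cast hd
  have hq : 0 < (2 * (k : ℝ) - 1) ^ n := pow_pos (by linarith) n
  have hdn : κ * d ^ 2 ≤ n / (8 * k) := by
    have h1 : (d : ℝ) ^ 2 ≤ R ^ 2 * n := by
      rw [← Real.sq_sqrt n.cast_nonneg, ← mul_pow]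
      gcongr
    rw [hκdef, div_mul_eq_mul_div, one_mul, div_le_div_iff₀ (by positivity) (by positivity)]
    nlinarith
  have hterm : ∀ a : Fin k → ZMod d, wordSum k n (∑ j, cosMod d (a j)) / (2 * k - 1) ^ n ≤
      2 * k * ∏ j, Real.exp (-(κ * (d ^ 2 * (1 - cosMod d (a j) ^ 2)))) := by
    intro a
    rw [div_le_iff₀ hq]
    refine (le_abs_self _).trans ((abs_wordSum_le hk (abs_sum_cosMod_le a) n).trans ?_)
    rw [mul_comm ((2 * (k : ℝ) - 1) ^ n), ← mul_assoc]
    gcongr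
    rw [← Real.exp_sum]
    refine Real.exp_le_exp.2 ?_
    rw [Finset.sum_neg_distrib]
    refine neg_le_neg ?_
    -- `1 - c ^ 2 ≤ 2 * (1 - |c|)` replaces `k - |S|` by a sum over the coordinates that treats
    -- the two extremal characters alike
    have h1 : ∑ j, (1 - cosMod d (a j) ^ 2) / 2 ≤ k - |∑ j, cosMod d (a j)| := by
      have h2 : ∑ j, (1 - cosMod d (a j) ^ 2) / 2 ≤ ∑ j, (1 - |cosMod d (a j)|) := by
        refine Finset.sum_le_sum fun j _ => ?_
        have := abs_cosMod_le_one (a j)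
        nlinarith [sq_abs (cosMod d (a j)), abs_nonneg (cosMod d (a j))]
      refine h2.trans ?_
      rw [Finset.sum_sub_distrib]
      have := Finset.abs_sum_le_sum_abs (fun j => cosMod d (a j)) Finset.univ
      simp only [Finset.sum_const, Finset.card_univ, Fintype.card_fin, nsmul_eq_mul, mul_one]
      linarith
    have hnn : ∀ j, 0 ≤ 1 - cosMod d (a j) ^ 2 := fun j => by
      rw [one_sub_cosMod_sq]; positivity
    calc ∑ j, κ * (d ^ 2 * (1 - cosMod d (a j) ^ 2))
        = κ * d ^ 2 * ∑ j, (1 - cosMod d (a j) ^ 2) := by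
          rw [Finset.mul_sum]; refine Finset.sum_congr rfl fun j _ => by ring
      _ ≤ n / (8 * k) * ∑ j, (1 - cosMod d (a j) ^ 2) := by
          gcongr
          exact Finset.sum_nonneg fun j _ => hnn j
      _ = n * ((∑ j, (1 - cosMod d (a j) ^ 2) / 2) / (4 * k)) := by
          rw [← Finset.sum_div]; field_simp; ring
      _ ≤ _ := by gcongr
  have hprod : ∑ a : Fin k → ZMod d, ∏ j, Real.exp (-(κ * (d ^ 2 * (1 - cosMod d (a j) ^ 2)))) =
      (∑ a : ZMod d, Real.exp (-(κ * (d ^ 2 * (1 - cosMod d a ^ 2))))) ^ k := by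
    classical
    have := Finset.prod_univ_sum (fun _ : Fin k => (Finset.univ : Finset (ZMod d)))
      (fun _ x => Real.exp (-(κ * (d ^ 2 * (1 - cosMod d x ^ 2)))))
    rw [Fintype.piFinset_univ] at this
    rw [← this]
    simp
  rw [wordFrequency_divisible hn]
  calc (∑ a : Fin k → ZMod d, wordSum k n (∑ j, cosMod d (a j)) / (2 * k - 1) ^ n) / d ^ k
      ≤ (2 * k * G ^ k) / d ^ k := by
        gcongr
        refine (Finset.sum_le_sum fun a _ => hterm a).trans ?_
        rw [← Finset.mul_sum, hprod]
        gcongr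
        exact sum_exp_neg_mul_le hκ d
    _ ≤ (2 * k * G ^ k) / d ^ 2 := by gcongr
    _ = _ := div_eq_mul_inv _ _

/-- The exponential moments of the exponent sums on the scale `√n` are bounded. -/
theorem wordSum_cosh_le {k : ℕ} (hk : 2 ≤ k) {n : ℕ} (hn : 0 < n) {s : ℝ} (hs : s ^ 2 * n = 1) :
    wordSum k n (k + (Real.cosh s - 1)) ≤ 2 * k * (Real.exp 1 * (2 * k - 1) ^ n) := by
  have hk' : (2 : ℝ) ≤ k := by exact_mod_cast hk
  have hn' : (1 : ℝ) ≤ n := by exact_mod_cast hn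
  have hs1 : s ^ 2 ≤ 1 := by nlinarith [sq_nonneg s]
  have hcosh : Real.cosh s - 1 ≤ s ^ 2 := by
    have h1 := Real.cosh_le_exp_half_sq s
    have h2 := Real.abs_exp_sub_one_le (x := s ^ 2 / 2)
      (by rw [abs_of_nonneg (by positivity)]; linarith)
    rw [abs_of_nonneg (a := s ^ 2 / 2) (by positivity)] at h2
    linarith [le_abs_self (Real.exp (s ^ 2 / 2) - 1)]
  have h1 := abs_wordSum_le_of_ge hk (S := k + (Real.cosh s - 1))
    (by linarith [Real.one_le_cosh s]) n
  refine (le_abs_self _).trans (h1.trans ?_)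
  rw [mul_comm (Real.exp 1)]
  have hq : 0 < (2 * (k : ℝ) - 1) ^ n := pow_pos (by linarith) n
  gcongr
  rw [add_sub_cancel_left]
  have h2 : (Real.cosh s - 1) / (k - 1) ≤ Real.cosh s - 1 :=
    div_le_self (by linarith [Real.one_le_cosh s]) (by linarith)
  calc (n : ℝ) * ((Real.cosh s - 1) / (k - 1)) ≤ n * s ^ 2 := by gcongr; linarith
    _ = 1 := by rw [mul_comm]; exact hs

/-- The points with a coordinate of absolute value larger than `T`. -/
def farPoints (k : ℕ) (T : ℝ) : Set (Fin k → ℤ) := {v | ∃ i, T < |(v i : ℝ)|}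

theorem wordFrequency_farPoints_le {k : ℕ} (hk : 2 ≤ k) (R : ℝ) {n : ℕ} (hn : 0 < n) :
    wordFrequency (farPoints k (R * √n)) n ≤ 4 * k ^ 2 * Real.exp 1 * Real.exp (-R) := by
  classical
  have hk' : (2 : ℝ) ≤ k := by exact_mod_cast hk
  have hq : 0 < (2 * (k : ℝ) - 1) ^ n := pow_pos (by linarith) n
  have hsq : 0 < √(n : ℝ) := Real.sqrt_pos.2 (by exact_mod_cast hn)
  set s : ℝ := 1 / √n with hs
  have hs0 : 0 < s := by positivity
  have hs2 : s ^ 2 * n = 1 := by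
    rw [hs, div_pow, Real.sq_sqrt n.cast_nonneg]
    field_simp
  have hsR : s * (R * √n) = R := by rw [hs]; field_simp
  -- Markov's inequality for the sum of `exp (± s Φ i)` over all coordinates and signs
  have hmarkov : Real.exp R * (cyclicWordsIn (farPoints k (R * √n)) n).card ≤
      ∑ L ∈ cyclicWords k n, ∑ i, (Real.exp (s * logVector (FreeGroup.mk L) i)
        + Real.exp (-s * logVector (FreeGroup.mk L) i)) := by
    have hpos : ∀ L : List (Fin k × Bool), ∀ i : Fin k,
        0 ≤ Real.exp (s * logVector (FreeGroup.mk L) i)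
          + Real.exp (-s * logVector (FreeGroup.mk L) i) := fun L i => by positivity
    refine le_trans ?_ (Finset.sum_le_sum_of_subset_of_nonneg
      (Finset.filter_subset (fun L => logVector (FreeGroup.mk L) ∈ farPoints k (R * √n)) _)
      fun L _ _ => Finset.sum_nonneg fun i _ => hpos L i)
    rw [mul_comm, ← nsmul_eq_mul]
    refine Finset.card_nsmul_le_sum _ _ _ fun L hL => ?_
    obtain ⟨i, hi⟩ := (Finset.mem_filter.1 hL).2
    refine le_trans ?_ (Finset.single_le_sum (fun i _ => hpos L i) (Finset.mem_univ i))
    set x : ℝ := ((logVector (FreeGroup.mk L) i : ℤ) : ℝ)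
    have hx : R ≤ s * |x| := by
      rw [← hsR]; exact mul_le_mul_of_nonneg_left hi.le hs0.le
    rcases abs_choice x with h | h
    · have := Real.exp_le_exp.2 (h ▸ hx)
      linarith [Real.exp_pos (-s * x)]
    · rw [h] at hx
      have := Real.exp_le_exp.2 (hx.trans_eq (show s * -x = -s * x by ring))
      linarith [Real.exp_pos (s * x)]
  have hmom : ∑ L ∈ cyclicWords k n, ∑ i, (Real.exp (s * logVector (FreeGroup.mk L) i)
        + Real.exp (-s * logVector (FreeGroup.mk L) i)) ≤
      4 * k ^ 2 * Real.exp 1 * (2 * k - 1) ^ n := by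
    rw [Finset.sum_comm]
    have hb : ∀ i ∈ (Finset.univ : Finset (Fin k)),
        ∑ L ∈ cyclicWords k n, (Real.exp (s * logVector (FreeGroup.mk L) i)
          + Real.exp (-s * logVector (FreeGroup.mk L) i)) ≤
        2 * (2 * k * (Real.exp 1 * (2 * k - 1) ^ n)) := by
      intro i _
      rw [Finset.sum_add_distrib, sum_cyclicWords_exp hn, sum_cyclicWords_exp hn, Real.cosh_neg]
      linarith [wordSum_cosh_le hk hn hs2]
    refine (Finset.sum_le_card_nsmul _ _ _ hb).trans_eq ?_
    simp only [Finset.card_univ, Fintype.card_fin, nsmul_eq_mul]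
    ring
  rw [wordFrequency, div_le_iff₀ hq, Real.exp_neg]
  have h := hmarkov.trans hmom
  rw [mul_comm (Real.exp R), ← le_div_iff₀ (Real.exp_pos R)] at h
  refine h.trans_eq ?_
  field_simp

/-! ### The sieve -/

open scoped ArithmeticFunction.Moebius ArithmeticFunction.zeta

/-- The greatest common divisor of the coordinates, as a natural number. -/
def coordGcd {k : ℕ} (v : Fin k → ℤ) : ℕ := (Finset.univ.gcd v).natAbs

theorem mem_divisiblePoints_iff {k d : ℕ} {v : Fin k → ℤ} :
    v ∈ divisiblePoints k d ↔ d ∣ coordGcd v := by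
  rw [coordGcd, ← Int.natCast_dvd, Finset.dvd_gcd_iff]
  simp [divisiblePoints]

theorem mem_coprimePoints_iff {k : ℕ} {v : Fin k → ℤ} :
    v ∈ coprimePoints k ↔ coordGcd v = 1 := by
  have h : Finset.univ.gcd v = (coordGcd v : ℤ) := by
    rw [coordGcd, Int.natCast_natAbs, Int.abs_eq_normalize, Finset.normalize_gcd]
  change Finset.univ.gcd v = 1 ↔ _
  rw [h]
  norm_cast

/-- The points for which the greatest common divisor of the coordinates is prime to `P`. -/
def sievedPoints (k P : ℕ) : Set (Fin k → ℤ) := {v | (coordGcd v).Coprime P}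

theorem sum_moebius_divisors_eq (g : ℕ) {P : ℕ} (hP : P ≠ 0) :
    ∑ d ∈ P.divisors, (if d ∣ g then (μ d : ℝ) else 0) = if g.Coprime P then 1 else 0 := by
  rw [← Finset.sum_filter]
  have hset : P.divisors.filter (fun d => d ∣ g) = (g.gcd P).divisors := by
    ext d
    simp only [Finset.mem_filter, Nat.mem_divisors, Nat.dvd_gcd_iff]
    have : g.gcd P ≠ 0 := fun h => hP (Nat.gcd_eq_zero_iff.1 h).2
    tauto
  have h := congrArg (fun f => f (g.gcd P)) ArithmeticFunction.moebius_mul_coe_zeta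
  simp only [ArithmeticFunction.coe_mul_zeta_apply, ArithmeticFunction.one_apply] at h
  rw [hset, ← Int.cast_sum, h]
  by_cases hc : g.Coprime P
  · rw [if_pos hc, if_pos (show g.gcd P = 1 from hc), Int.cast_one]
  · rw [if_neg hc, if_neg (show ¬ g.gcd P = 1 from hc), Int.cast_zero]

theorem wordFrequency_sievedPoints (k : ℕ) {P : ℕ} (hP : P ≠ 0) (n : ℕ) :
    wordFrequency (sievedPoints k P) n =
      ∑ d ∈ P.divisors, (μ d : ℝ) * wordFrequency (divisiblePoints k d) n := by
  classical
  have hcard : ∀ B : Set (Fin k → ℤ), ((cyclicWordsIn B n).card : ℝ) =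
      ∑ L ∈ cyclicWords k n, if logVector (FreeGroup.mk L) ∈ B then (1 : ℝ) else 0 := by
    intro B
    rw [cyclicWordsIn, ← Finset.sum_filter, Finset.sum_const, nsmul_eq_mul, mul_one]
  simp only [wordFrequency, ← mul_div_assoc]
  rw [← Finset.sum_div]
  congr 1
  simp only [hcard, Finset.mul_sum]
  rw [Finset.sum_comm]
  refine Finset.sum_congr rfl fun L _ => ?_
  simp only [mem_divisiblePoints_iff, mul_ite, mul_one, mul_zero]
  rw [sum_moebius_divisors_eq _ hP]
  exact if_congr Iff.rfl rfl rfl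

theorem tendsto_wordFrequency_sievedPoints {k : ℕ} (hk : 2 ≤ k) {P : ℕ} (hP : P ≠ 0) :
    Tendsto (fun n => wordFrequency (sievedPoints k P) n
      + wordFrequency (sievedPoints k P) (n + 1)) atTop
      (𝓝 (2 * ∑ d ∈ P.divisors, (μ d : ℝ) / d ^ k)) := by
  have h := tendsto_finsetSum P.divisors fun d hd =>
    (tendsto_wordFrequency_divisible hk (Nat.pos_of_mem_divisors hd)).const_mul (μ d : ℝ)
  rw [Finset.mul_sum]
  simp only [wordFrequency_sievedPoints k hP, ← Finset.sum_add_distrib, ← mul_add]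
  refine h.trans_eq ?_
  congr 1
  exact Finset.sum_congr rfl fun d _ => by ring

theorem wordFrequency_mono {k : ℕ} (hk : 2 ≤ k) {B B' : Set (Fin k → ℤ)} (h : B ⊆ B') (n : ℕ) :
    wordFrequency B n ≤ wordFrequency B' n := by
  classical
  have hk' : (2 : ℝ) ≤ k := by exact_mod_cast hk
  have hq : 0 < (2 * (k : ℝ) - 1) ^ n := pow_pos (by linarith) n
  rw [wordFrequency, wordFrequency]
  gcongr
  intro L hL
  rw [mem_cyclicWordsIn] at hL ⊢
  exact ⟨hL.1, h hL.2⟩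

/-- A point whose greatest common divisor `g` is prime to `M !` but different from `1` has
`g > M`. It is either far from the origin or divisible by some `d` with `M < d ≤ T`. -/
theorem mem_of_mem_sievedPoints {k M : ℕ} (hM : 2 ≤ M) {T : ℝ} {v : Fin k → ℤ}
    (hv : v ∈ sievedPoints k M.factorial) (hc : v ∉ coprimePoints k) (hf : v ∉ farPoints k T) :
    ∃ d ∈ Finset.Ioc M ⌊T⌋₊, v ∈ divisiblePoints k d := by
  rw [mem_coprimePoints_iff] at hc
  have hcop : (coordGcd v).Coprime M.factorial := hv
  have h0 : coordGcd v ≠ 0 := by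
    intro h
    rw [h, Nat.coprime_zero_left] at hcop
    have := Nat.self_le_factorial M
    omega
  have hMg : M < coordGcd v := by
    by_contra! h
    exact hc (Nat.Coprime.eq_one_of_dvd hcop (Nat.dvd_factorial (Nat.pos_of_ne_zero h0) h))
  refine ⟨coordGcd v, Finset.mem_Ioc.2 ⟨hMg, ?_⟩, mem_divisiblePoints_iff.2 dvd_rfl⟩
  have hex : ∃ i, v i ≠ 0 := by
    by_contra! h
    refine h0 ?_
    rw [coordGcd, Int.natAbs_eq_zero, Finset.gcd_eq_zero_iff]
    exact fun i _ => h i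
  obtain ⟨i, hi⟩ := hex
  have hdvd : (coordGcd v : ℤ) ∣ v i := mem_divisiblePoints_iff.2 (dvd_refl (coordGcd v)) i
  have hle : (coordGcd v : ℤ) ≤ |v i| := Int.le_of_dvd (abs_pos.2 hi) ((dvd_abs _ _).2 hdvd)
  have hT : |(v i : ℝ)| ≤ T := by
    by_contra! h
    exact hf ⟨i, h⟩
  refine Nat.le_floor (le_trans ?_ hT)
  exact_mod_cast hle

/-- The sieve error, given a uniform bound for divisibility by `d ≤ R √n`. -/
theorem wordFrequency_sievedPoints_sub_le {k : ℕ} (hk : 2 ≤ k) {M : ℕ} (hM : 2 ≤ M) {R C : ℝ}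
    (hC0 : 0 ≤ C) (hC : ∀ n d : ℕ, 0 < n → 0 < d → (d : ℝ) ≤ R * √n →
      wordFrequency (divisiblePoints k d) n ≤ C * ((d : ℝ) ^ 2)⁻¹) {n : ℕ} (hn : 0 < n) :
    wordFrequency (sievedPoints k M.factorial) n - wordFrequency (coprimePoints k) n ≤
      C / M + 4 * k ^ 2 * Real.exp 1 * Real.exp (-R) := by
  classical
  have hk' : (2 : ℝ) ≤ k := by exact_mod_cast hk
  have hq : 0 < (2 * (k : ℝ) - 1) ^ n := pow_pos (by linarith) n
  set N := ⌊R * √(n : ℝ)⌋₊ with hN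
  have hsub : cyclicWordsIn (sievedPoints k M.factorial) n ⊆
      (cyclicWordsIn (coprimePoints k) n ∪ cyclicWordsIn (farPoints k (R * √n)) n) ∪
        (Finset.Ioc M N).biUnion fun d => cyclicWordsIn (divisiblePoints k d) n := by
    intro L hL
    simp only [Finset.mem_union, Finset.mem_biUnion]
    rw [mem_cyclicWordsIn] at hL
    by_cases hc : logVector (FreeGroup.mk L) ∈ coprimePoints k
    · exact Or.inl (Or.inl (mem_cyclicWordsIn.2 ⟨hL.1, hc⟩))
    by_cases hf : logVector (FreeGroup.mk L) ∈ farPoints k (R * √n)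
    · exact Or.inl (Or.inr (mem_cyclicWordsIn.2 ⟨hL.1, hf⟩))
    obtain ⟨d, hd, hdv⟩ := mem_of_mem_sievedPoints hM hL.2 hc hf
    exact Or.inr ⟨d, hd, mem_cyclicWordsIn.2 ⟨hL.1, hdv⟩⟩
  have hcard : ((cyclicWordsIn (sievedPoints k M.factorial) n).card : ℝ) ≤
      ((cyclicWordsIn (coprimePoints k) n).card + (cyclicWordsIn (farPoints k (R * √n)) n).card) +
        ∑ d ∈ Finset.Ioc M N, ((cyclicWordsIn (divisiblePoints k d) n).card : ℝ) := by
    have h1 := (Finset.card_le_card hsub).trans (Finset.card_union_le _ _)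
    have h2 := Finset.card_union_le (cyclicWordsIn (coprimePoints k) n)
      (cyclicWordsIn (farPoints k (R * √n)) n)
    have h3 := Finset.card_biUnion_le (s := Finset.Ioc M N)
      (t := fun d => cyclicWordsIn (divisiblePoints k d) n)
    exact_mod_cast h1.trans (add_le_add h2 h3)
  have hfreq : wordFrequency (sievedPoints k M.factorial) n ≤
      (wordFrequency (coprimePoints k) n + wordFrequency (farPoints k (R * √n)) n) +
        ∑ d ∈ Finset.Ioc M N, wordFrequency (divisiblePoints k d) n := by
    simp only [wordFrequency]
    rw [← Finset.sum_div, ← add_div, ← add_div]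
    gcongr
  have hsum : ∑ d ∈ Finset.Ioc M N, wordFrequency (divisiblePoints k d) n ≤ C / M := by
    have h1 : ∑ d ∈ Finset.Ioc M N, wordFrequency (divisiblePoints k d) n ≤
        ∑ d ∈ Finset.Ioc M N, C * ((d : ℝ) ^ 2)⁻¹ := by
      refine Finset.sum_le_sum fun d hd => ?_
      rw [Finset.mem_Ioc] at hd
      exact hC n d hn (by omega) ((Nat.le_floor_iff' (by omega)).1 hd.2)
    refine h1.trans ?_
    rw [← Finset.mul_sum, div_eq_mul_inv]
    refine mul_le_mul_of_nonneg_left ?_ hC0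
    rcases le_or_gt M N with h | h
    · refine (sum_Ioc_inv_sq_le_sub (by omega) h).trans ?_
      have : (0 : ℝ) ≤ (N : ℝ)⁻¹ := by positivity
      linarith
    · rw [Finset.Ioc_eq_empty_of_le h.le, Finset.sum_empty]
      positivity
  have hfar := wordFrequency_farPoints_le hk R hn
  linarith

/-- The reciprocal of `ζ(k)` as a real Dirichlet series. The term at `d = 0` vanishes. -/
noncomputable def zetaInv (k : ℕ) : ℝ := ∑' d : ℕ, (μ d : ℝ) / d ^ k

theorem summable_moebius_div_pow {k : ℕ} (hk : 2 ≤ k) :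
    Summable fun d : ℕ => (μ d : ℝ) / d ^ k := by
  refine Summable.of_norm_bounded (Real.summable_one_div_nat_pow.2 (show 1 < k by omega))
    fun d => ?_
  rw [norm_div, Real.norm_eq_abs, Real.norm_of_nonneg (by positivity)]
  gcongr
  exact_mod_cast ArithmeticFunction.abs_moebius_le_one

theorem ofReal_zetaInv {k : ℕ} (hk : 2 ≤ k) : ((zetaInv k : ℝ) : ℂ) = 1 / riemannZeta k := by
  have hre : 1 < ((k : ℂ)).re := by
    rw [Complex.natCast_re]
    exact_mod_cast (show 1 < k by omega)
  have h := LSeries_one_mul_Lseries_moebius hre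
  rw [LSeries_one_eq_riemannZeta hre] at h
  have hL : LSeries (fun d => ((μ d : ℤ) : ℂ)) k = ((zetaInv k : ℝ) : ℂ) := by
    rw [LSeries, zetaInv, Complex.ofReal_tsum]
    refine tsum_congr fun d => ?_
    rcases eq_or_ne d 0 with rfl | hd
    · simp
    · rw [LSeries.term_of_ne_zero hd, Complex.cpow_natCast]
      push_cast
      rfl
  rw [hL] at h
  exact eq_one_div_of_mul_eq_one_right h

theorem tendsto_sum_divisors_factorial {k : ℕ} (hk : 2 ≤ k) :
    Tendsto (fun M : ℕ => ∑ d ∈ M.factorial.divisors, (μ d : ℝ) / d ^ k) atTop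
      (𝓝 (zetaInv k)) := by
  -- `0` belongs to no set of divisors, so it is adjoined; its term vanishes
  have hset : Tendsto (fun M : ℕ => insert 0 M.factorial.divisors) atTop atTop := by
    refine tendsto_atTop_finset_of_monotone ?_ fun d => ?_
    · intro M N h
      refine Finset.insert_subset_insert _ (Nat.divisors_subset_of_dvd (Nat.factorial_ne_zero N)
        (Nat.factorial_dvd_factorial h))
    · rcases Nat.eq_zero_or_pos d with rfl | hd
      · exact ⟨0, Finset.mem_insert_self _ _⟩
      · refine ⟨d, Finset.mem_insert_of_mem (Nat.mem_divisors.2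
          ⟨Nat.dvd_factorial hd le_rfl, Nat.factorial_ne_zero d⟩)⟩
  refine ((summable_moebius_div_pow hk).hasSum.comp hset).congr fun M => ?_
  rw [Function.comp_apply, Finset.sum_insert (by simp)]
  simp

/-- Words with relatively prime exponent sums have frequency `1 / ζ(k)`, on average over two
consecutive lengths. -/
theorem tendsto_wordFrequency_coprimePoints {k : ℕ} (hk : 2 ≤ k) :
    Tendsto (fun n => wordFrequency (coprimePoints k) n + wordFrequency (coprimePoints k) (n + 1))
      atTop (𝓝 (2 * zetaInv k)) := by
  rw [Metric.tendsto_nhds]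
  intro ε hε
  have hR : Tendsto (fun R : ℝ => 4 * (k : ℝ) ^ 2 * Real.exp 1 * Real.exp (-R)) atTop (𝓝 0) := by
    have := (Real.tendsto_exp_neg_atTop_nhds_zero).const_mul (4 * (k : ℝ) ^ 2 * Real.exp 1)
    rwa [mul_zero] at this
  obtain ⟨R, hRε, hR0⟩ := ((hR.eventually (gt_mem_nhds (show 0 < ε / 8 by linarith))).and
    (eventually_gt_atTop 0)).exists
  obtain ⟨C, hC0, hC⟩ := exists_wordFrequency_divisible_le hk hR0
  have hM : Tendsto (fun M : ℕ => C / (M : ℝ)) atTop (𝓝 0) :=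
    tendsto_const_div_atTop_nhds_zero_nat C
  obtain ⟨M, ⟨hMε, hMsum⟩, hM2⟩ := (((hM.eventually (gt_mem_nhds (show 0 < ε / 8 by linarith))).and
    ((Metric.tendsto_nhds.1 (tendsto_sum_divisors_factorial hk)) (ε / 8) (by linarith))).and
    (eventually_ge_atTop 2)).exists
  have hlim := (Metric.tendsto_nhds.1
    (tendsto_wordFrequency_sievedPoints hk (Nat.factorial_ne_zero M))) (ε / 8) (by linarith)
  filter_upwards [hlim, eventually_gt_atTop 0] with n hn hn0
  have hsub : coprimePoints k ⊆ sievedPoints k M.factorial := by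
    intro v hv
    rw [mem_coprimePoints_iff] at hv
    change (coordGcd v).Coprime _
    rw [hv]
    exact Nat.coprime_one_left _
  have h1 := wordFrequency_mono hk hsub n
  have h2 := wordFrequency_mono hk hsub (n + 1)
  have h3 := wordFrequency_sievedPoints_sub_le hk hM2 hC0 hC hn0
  have h4 := wordFrequency_sievedPoints_sub_le hk hM2 hC0 hC n.succ_pos
  rw [Real.dist_eq, abs_lt] at hn hMsum ⊢
  constructor <;> linarith [hn.1, hn.2, hMsum.1, hMsum.2]

/-! ### From words to conjugacy classes -/

open Asymptotics

/-- If the terms of a divergent series with nonnegative terms `N n` asymptotically grow by the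
factor `q`, and the terms `x n = O(N n)` asymptotically alternate, in the sense that
`x (n + 1) + q * x n = o(N n)`, then the averages of `x` with weights `N` alternate as well. -/
theorem tendsto_weighted_average_add {N x : ℕ → ℝ} {q K : ℝ} (hq : 0 < q) (hN : ∀ n, 0 ≤ N n)
    (hsum : Tendsto (fun m => ∑ n ∈ Finset.range m, N n) atTop atTop)
    (hgrow : (fun n => N (n + 1) - q * N n) =o[atTop] N)
    (halt : (fun n => x (n + 1) + q * x n) =o[atTop] N) (hx : ∀ n, |x n| ≤ K * N n) :
    Tendsto (fun m => (∑ n ∈ Finset.range m, x n) / (∑ n ∈ Finset.range m, N n) +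
      (∑ n ∈ Finset.range (m + 1), x n) / (∑ n ∈ Finset.range (m + 1), N n)) atTop (𝓝 0) := by
  set P : ℕ → ℝ := fun m => ∑ n ∈ Finset.range m, N n with hP
  set X : ℕ → ℝ := fun m => ∑ n ∈ Finset.range m, x n with hX
  have hP0 : ∀ m, 0 ≤ P m := fun m => Finset.sum_nonneg fun n _ => hN n
  have hpos : ∀ᶠ m in atTop, 0 < P m := hsum.eventually_gt_atTop 0
  have hconst : ∀ c : ℝ, Tendsto (fun m => c / P m) atTop (𝓝 0) := fun c =>
    hsum.const_div_atTop c
  have h1 : Tendsto (fun m => P (m + 1) / P m) atTop (𝓝 q) := by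
    have h := (hgrow.sum_range hN hsum).tendsto_div_nhds_zero
    have h' := (h.add (hconst (N 0))).const_add q
    rw [add_zero, add_zero] at h'
    refine h'.congr' ?_
    filter_upwards [hpos] with m hm
    have e : ∑ n ∈ Finset.range m, (N (n + 1) - q * N n) = P (m + 1) - N 0 - q * P m := by
      rw [Finset.sum_sub_distrib, ← Finset.mul_sum]
      simp only [hP]
      rw [Finset.sum_range_succ' N m]
      ring
    have hm' := hm.ne'
    rw [e]
    change q + ((P (m + 1) - N 0 - q * P m) / P m + N 0 / P m) = _
    field_simp
    ring
  have h2 : Tendsto (fun m => (X (m + 1) + q * X m) / P m) atTop (𝓝 0) := by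
    have h := (halt.sum_range hN hsum).tendsto_div_nhds_zero
    have h' := h.add (hconst (x 0))
    rw [add_zero] at h'
    refine h'.congr fun m => ?_
    have e : ∑ n ∈ Finset.range m, (x (n + 1) + q * x n) = X (m + 1) - x 0 + q * X m := by
      rw [Finset.sum_add_distrib, ← Finset.mul_sum]
      simp only [hX]
      rw [Finset.sum_range_succ' x m]
      ring
    rw [e, ← add_div]
    congr 1
    ring
  have hXP : ∀ m, |X m| ≤ K * P m := by
    intro m
    rw [hP, Finset.mul_sum]
    exact (Finset.abs_sum_le_sum_abs _ _).trans (Finset.sum_le_sum fun n _ => hx n)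
  have h3 : Tendsto (fun m => X (m + 1) / P (m + 1) * (1 - P (m + 1) / P m / q)) atTop (𝓝 0) := by
    have hz : Tendsto (fun m => 1 - P (m + 1) / P m / q) atTop (𝓝 0) := by
      have := (h1.div_const q).const_sub 1
      rwa [div_self hq.ne', sub_self] at this
    refine Tendsto.zero_mul_isBoundedUnder_le (f := fun m => 1 - P (m + 1) / P m / q)
      (g := fun m => X (m + 1) / P (m + 1)) hz ?_ |>.congr fun m => mul_comm _ _
    refine isBoundedUnder_of ⟨|K|, fun m => ?_⟩
    simp only [Function.comp_apply, Real.norm_eq_abs]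
    rw [abs_div, abs_of_nonneg (hP0 _)]
    refine div_le_of_le_mul₀ (hP0 _) (abs_nonneg K) ((hXP _).trans ?_)
    exact mul_le_mul_of_nonneg_right (le_abs_self K) (hP0 _)
  have h4 := (h2.div_const q).add h3
  rw [zero_div, add_zero] at h4
  refine h4.congr' ?_
  filter_upwards [hpos, (tendsto_add_atTop_nat 1).eventually hpos] with m hm hm1
  change _ = X m / P m + X (m + 1) / P (m + 1)
  have := hm.ne'
  have := hm1.ne'
  field_simp
  ring

/-- The error made in replacing conjugacy classes by cyclically reduced words. -/
theorem abs_mul_card_classesIn_sub_le {k : ℕ} (hk : 2 ≤ k) (B : Set (Fin k → ℤ)) {n : ℕ}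
    (hn : 0 < n) :
    |n * (classesIn B n).card / (2 * (k : ℝ) - 1) ^ n - wordFrequency B n| ≤
      n ^ 2 * (√(2 * k) / (2 * k - 1)) ^ n := by
  have hk' : (2 : ℝ) ≤ k := by exact_mod_cast hk
  have hq : 0 < (2 * (k : ℝ) - 1) ^ n := pow_pos (by linarith) n
  have h1 : ((cyclicWordsIn B n).card : ℝ) ≤ n * (classesIn B n).card := by
    exact_mod_cast card_cyclicWordsIn_le B hn
  have h2 : (n : ℝ) * (classesIn B n).card ≤
      (cyclicWordsIn B n).card + n * (symmetricLists (Fin k × Bool) n).card := by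
    exact_mod_cast mul_card_classesIn_le B n
  have h3 : ((symmetricLists (Fin k × Bool) n).card : ℝ) ≤ n * √(2 * k) ^ n := by
    have : Nonempty (Fin k × Bool) := ⟨(⟨0, by omega⟩, true)⟩
    have h := card_symmetricLists_le (α := Fin k × Bool) n
    have hcard : Fintype.card (Fin k × Bool) = 2 * k := by simp [mul_comm]
    rw [hcard] at h
    have h' : ((symmetricLists (Fin k × Bool) n).card : ℝ) ≤ n * (2 * (k : ℝ)) ^ (n / 2) := by
      exact_mod_cast h
    refine h'.trans (mul_le_mul_of_nonneg_left ?_ n.cast_nonneg)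
    have hs : √(2 * (k : ℝ)) ^ 2 = 2 * k := Real.sq_sqrt (by linarith)
    have hs1 : 1 ≤ √(2 * (k : ℝ)) := by rw [Real.one_le_sqrt]; linarith
    calc (2 * (k : ℝ)) ^ (n / 2) = √(2 * (k : ℝ)) ^ (2 * (n / 2)) := by rw [pow_mul, hs]
      _ ≤ _ := pow_le_pow_right₀ hs1 (Nat.mul_div_le n 2)
  rw [wordFrequency, ← sub_div, abs_div, abs_of_pos hq, abs_of_nonneg (by linarith), div_pow,
    ← mul_div_assoc]
  gcongr
  nlinarith [(Nat.cast_nonneg n : (0 : ℝ) ≤ n)]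

theorem tendsto_mul_card_classesIn_sub {k : ℕ} (hk : 2 ≤ k) (B : Set (Fin k → ℤ)) :
    Tendsto (fun n : ℕ => n * (classesIn B n).card / (2 * (k : ℝ) - 1) ^ n - wordFrequency B n)
      atTop (𝓝 0) := by
  have hk' : (2 : ℝ) ≤ k := by exact_mod_cast hk
  have hr : √(2 * (k : ℝ)) / (2 * k - 1) < 1 := by
    rw [div_lt_one (by linarith), Real.sqrt_lt' (by linarith)]
    nlinarith
  refine squeeze_zero_norm' ?_ (tendsto_pow_const_mul_const_pow_of_lt_one 2
    (div_nonneg (Real.sqrt_nonneg _) (by linarith)) hr)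
  filter_upwards [eventually_gt_atTop 0] with n hn
  exact abs_mul_card_classesIn_sub_le hk B hn

theorem tendsto_wordFrequency_univ {k : ℕ} (hk : 2 ≤ k) :
    Tendsto (fun n => wordFrequency (Set.univ : Set (Fin k → ℤ)) n) atTop (𝓝 1) := by
  refine (tendsto_wordSum_self hk).congr' ?_
  filter_upwards [eventually_gt_atTop 0] with n hn
  have : cyclicWordsIn (Set.univ : Set (Fin k → ℤ)) n = cyclicWords k n := by
    simp [cyclicWordsIn]
  rw [wordFrequency, this, card_cyclicWords hn, wordSum_self]

/-- Passing from the counts of conjugacy classes of given length to cumulative counts. -/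
theorem tendsto_classCountIn_coprimePoints {k : ℕ} (hk : 2 ≤ k) :
    Tendsto (fun m : ℕ => (1 / 2 : ℝ) *
        ((classCountIn (coprimePoints k) m : ℝ) / classCount k m
          + (classCountIn (coprimePoints k) (m + 1) : ℝ) / classCount k (m + 1)))
      atTop (𝓝 (zetaInv k)) := by
  have hk' : (2 : ℝ) ≤ k := by exact_mod_cast hk
  set q : ℝ := 2 * k - 1 with hq
  have hq0 : 0 < q := by linarith
  set l := zetaInv k with hl
  set N : ℕ → ℝ := fun n => (classesIn (Set.univ : Set (Fin k → ℤ)) n).card with hN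
  set c : ℕ → ℝ := fun n => (classesIn (coprimePoints k) n).card with hc
  set x : ℕ → ℝ := fun n => c n - l * N n with hx
  set u : ℕ → ℝ := fun n => n * N n / q ^ n with hu
  set y : ℕ → ℝ := fun n => n * x n / q ^ n with hy
  have hN0 : ∀ n, 0 ≤ N n := fun n => Nat.cast_nonneg _
  have hcN : ∀ n, c n ≤ N n := by
    intro n
    simp only [hc, hN]
    refine Nat.cast_le.2 (Finset.card_le_card fun a ha => ?_)
    rw [mem_classesIn] at ha ⊢
    exact ⟨ha.1, Set.mem_univ _⟩
  have hxK : ∀ n, |x n| ≤ (1 + |l|) * N n := by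
    intro n
    refine (abs_sub _ _).trans ?_
    rw [abs_mul, abs_of_nonneg (hN0 n), abs_of_nonneg (Nat.cast_nonneg _ : 0 ≤ c n)]
    linarith [hcN n]
  have hu1 : Tendsto u atTop (𝓝 1) := by
    have := (tendsto_mul_card_classesIn_sub hk Set.univ).add (tendsto_wordFrequency_univ hk)
    simpa using this
  have hu1' : Tendsto (fun n => u (n + 1)) atTop (𝓝 1) := hu1.comp (tendsto_add_atTop_nat 1)
  have hyy : Tendsto (fun n => y n + y (n + 1)) atTop (𝓝 0) := by
    have h := tendsto_mul_card_classesIn_sub hk (coprimePoints k)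
    have h' := (h.add (h.comp (tendsto_add_atTop_nat 1))).add
      (tendsto_wordFrequency_coprimePoints hk)
    have h'' := h'.sub ((hu1.add hu1').const_mul l)
    have e : (0 : ℝ) + 0 + 2 * zetaInv k - l * (1 + 1) = 0 := by rw [hl]; ring
    rw [e] at h''
    refine h''.congr fun n => ?_
    simp only [Function.comp_apply, hy, hx, hu, hc, hN]
    ring
  have hy_le : ∀ n, |y n| ≤ (1 + |l|) * u n := by
    intro n
    have hqn : 0 < q ^ n := pow_pos hq0 n
    simp only [hy, hu]
    rw [abs_div, abs_mul, Nat.abs_cast, abs_of_pos hqn, ← mul_div_assoc]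
    refine div_le_div_of_nonneg_right ?_ hqn.le
    have := mul_le_mul_of_nonneg_left (hxK n) (Nat.cast_nonneg n : (0 : ℝ) ≤ n)
    linarith
  have hratio : Tendsto (fun n : ℕ => (n : ℝ) / (n + 1)) atTop (𝓝 1) :=
    tendsto_natCast_div_add_atTop 1
  have hupos : ∀ᶠ n in atTop, 0 < u n := hu1.eventually (lt_mem_nhds one_pos)
  have hNpos : ∀ᶠ n in atTop, 0 < N n := by
    filter_upwards [hupos] with n hn
    refine lt_of_le_of_ne (hN0 n) fun h => hn.ne' ?_
    simp [hu, ← h]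
  have hNu : ∀ᶠ n : ℕ in atTop, N n = u n * q ^ n / n := by
    filter_upwards [eventually_gt_atTop 0] with n hn
    have : (n : ℝ) ≠ 0 := by exact_mod_cast hn.ne'
    have := (pow_pos hq0 n).ne'
    simp only [hu]
    field_simp
  have hNe : ∀ᶠ n in atTop, N n ≠ 0 := hNpos.mono fun n h => h.ne'
  have hgrow : (fun n => N (n + 1) - q * N n) =o[atTop] N := by
    rw [isLittleO_iff_tendsto' (hNe.mono fun n h h0 => absurd h0 h)]
    have h := (((hu1'.div hu1 one_ne_zero).mul hratio).sub_const 1).const_mul q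
    have e : q * ((1 : ℝ) / 1 * 1 - 1) = 0 := by ring
    rw [e] at h
    refine h.congr' ?_
    filter_upwards [hupos, hNpos, eventually_gt_atTop 0] with n h1 h2 hn
    have hn' : (n : ℝ) ≠ 0 := by exact_mod_cast hn.ne'
    have hqn := (pow_pos hq0 n).ne'
    have h2' := h2.ne'
    simp only [Pi.div_apply, hu]
    push_cast
    rw [pow_succ]
    field_simp
  have halt : (fun n => x (n + 1) + q * x n) =o[atTop] N := by
    rw [isLittleO_iff_tendsto' (hNe.mono fun n h h0 => absurd h0 h)]
    have hb : Tendsto (fun n : ℕ => ((n : ℝ) / (n + 1) - 1) * y (n + 1)) atTop (𝓝 0) := by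
      have h1 : Tendsto (fun n : ℕ => (n : ℝ) / (n + 1) - 1) atTop (𝓝 0) := by
        simpa using hratio.sub_const 1
      refine h1.zero_mul_isBoundedUnder_le ?_
      refine ((hu1'.const_mul (1 + |l|)).isBoundedUnder_le).mono_le ?_
      exact Eventually.of_forall fun n => hy_le (n + 1)
    have h := (((hyy.add hb).div hu1 one_ne_zero)).const_mul q
    have e : q * (((0 : ℝ) + 0) / 1) = 0 := by ring
    rw [e] at h
    refine h.congr' ?_
    filter_upwards [hupos, hNpos, eventually_gt_atTop 0] with n h1 h2 hn
    have hn' : (n : ℝ) ≠ 0 := by exact_mod_cast hn.ne'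
    have hqn := (pow_pos hq0 n).ne'
    have h2' := h2.ne'
    simp only [Pi.div_apply, hu, hy]
    push_cast
    rw [pow_succ]
    field_simp
    ring
  have hsum : Tendsto (fun m => ∑ n ∈ Finset.range m, N n) atTop atTop := by
    rw [← not_summable_iff_tendsto_nat_atTop_of_nonneg hN0]
    intro hs
    obtain ⟨n, h1, h2⟩ := (hNpos.and
      (hs.tendsto_atTop_zero.eventually (gt_mem_nhds one_pos))).exists
    simp only [hN] at h1 h2
    norm_cast at h1 h2
    omega
  have hmain := tendsto_weighted_average_add hq0 hN0 hsum hgrow halt hxK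
  have hmain' := ((hmain.comp (tendsto_add_atTop_nat 1)).const_mul (1 / 2 : ℝ)).const_add l
  rw [mul_zero, add_zero] at hmain'
  refine hmain'.congr' ?_
  have hpos : ∀ᶠ m in atTop, 0 < ∑ n ∈ Finset.range (m + 1), N n :=
    (tendsto_add_atTop_nat 1).eventually (hsum.eventually_gt_atTop 0)
  filter_upwards [hpos, (tendsto_add_atTop_nat 1).eventually hpos] with m h1 h2
  have eN : ∀ m, (classCount k m : ℝ) = ∑ n ∈ Finset.range (m + 1), N n := by
    intro m
    rw [classCount_eq_classCountIn_univ, classCountIn_eq_sum]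
    push_cast
    rfl
  have ec : ∀ m, (classCountIn (coprimePoints k) m : ℝ) =
      ∑ n ∈ Finset.range (m + 1), x n + l * ∑ n ∈ Finset.range (m + 1), N n := by
    intro m
    rw [classCountIn_eq_sum, Finset.mul_sum, ← Finset.sum_add_distrib]
    push_cast
    refine Finset.sum_congr rfl fun n _ => ?_
    simp only [hx, hc]
    ring
  rw [eN, eN, ec, ec, add_div, add_div, mul_div_cancel_right₀ _ h1.ne',
    mul_div_cancel_right₀ _ h2.ne']
  simp only [Function.comp_apply]
  ring

end FreeGroupClasses

theorem corollary1p3 (k : ℕ) (hk : 2 ≤ k) :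
    Tendsto
      (fun m : ℕ =>
        (((1 / 2 : ℝ) *
          ((FreeGroupClasses.classCountIn (FreeGroupClasses.coprimePoints k) m : ℝ)
              / (FreeGroupClasses.classCount k m : ℝ)
            + (FreeGroupClasses.classCountIn (FreeGroupClasses.coprimePoints k) (m + 1) : ℝ)
              / (FreeGroupClasses.classCount k (m + 1) : ℝ)) : ℝ) : ℂ))
      atTop (𝓝 (1 / riemannZeta (k : ℂ))) := by
  rw [← FreeGroupClasses.ofReal_zetaInv hk]
  exact (Complex.continuous_ofReal.tendsto _).comp
    (FreeGroupClasses.tendsto_classCountIn_coprimePoints hk)
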